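/- **Setting.** Let $\Pi=\{0,1,2\}$ be the set of processes and $V^{in}=\Pi$ the set of input values; atomic propositions are $\mathtt{ip}_a^v$ ($a\in\Pi$, $v\in V^{in}$). A *simplicial model* $M$ is a simplicial complex with a vertex colouring $\chi$ in $\Pi$ that is injective on simplices, all of whose facets have $|\Pi|$ vertices, together with labels $l(x)\subseteq\{\mathtt{ip}_{\chi(x)}^v\mid v\in V^{in}\}$; put $l(X)=\bigcup_{x\in X}l(x)$, and let $\mathcal F(M)$ be the set of facets. A *morphism* is a vertex map preserving simplices, colours and labels. The input model $\mathcal I$ has vertices $(a,v)\in\Pi\times V^{in}$ labelled $\{\mathtt{ip}_a^v\}$ and coloured $a$, its simplices being the nonempty sets with at most one vertex of each colour. An *action model* $A$ is a complex of the same kind with a precondition formula $\mathsf{pre}(T)$ for each facet $T$; $\mathcal I[A]$ is the simplicial model whose facets are the sets $X\times_\Pi T$ of pairs of equally coloured vertices of $X$ and $T$, for facets $X,T$ with $\mathcal I,X\models\mathsf{pre}(T)$, with colour and label taken from the first component. *Set agreement* $\mathcal{SA}_2$: the facets are $\{(a,d_a)\mid a\in\Pi\}$ with $d:\Pi\to V^{in}$,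 $|d(\Pi)|\le 2$, and precondition $\bigwedge_a\bigvee_b \mathtt{ip}_b^{d_a}$. *Iterated immediate snapshot* $\mathcal{IS}^r$: an ordered partition is a sequence $\gamma=(C_1,\dots,C_l)$ with $\emptyset\ne C_1\subsetneq\dots\subsetneq C_l=\Pi$. For a facet $I=\{(a,i_a)\mid a\in\Pi\}$ of $\mathcal I$, put $view^0_a(I)=i_a$ and $view^{r+1}_a(I,\gamma_1,\dots,\gamma_{r+1})=\{(p,view^r_p(I,\gamma_1,\dots,\gamma_r))\mid p\in C\}$, where $C$ is the first set of $\gamma_{r+1}$ containing $a$. The facets are $\{(a,i_a,view^r_a(I,\gamma_1,\dots,\gamma_r))\mid a\in\Pi\}$, with precondition $\bigwedge_a\mathtt{ip}_a^{i_a}$. The corresponding facet of $\mathcal I[\mathcal{IS}^r]$ is denoted $I[\gamma_1,\dots,\gamma_r]$. Vertices of $\mathcal I[\mathcal{IS}^r]$ are written $(a,i_a,v_a)$ and those of $\mathcal I[\mathcal{SA}_2]$ are written $(a,i_a,d_a)$. For a view $v$ of level at least $1$, $car(v)$ is the set of pairs $(p,i_p)$ it contains after flattening: $car(v)=v$ at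 level $1$, and $car(v)=\bigcup_{(p,w)\in v}car(w)$ at higher levels. *Language* $\mathcal L_D^+$: $\varphi::=p\mid\neg p\mid\varphi\vee\varphi\mid\varphi\wedge\varphi\mid \mathrm D_A\varphi$ with $p$ an atomic proposition and $A\subseteq\Pi$. Here $M,X\models p$ iff $p\in l(X)$; $M,X\models\mathrm D_A\varphi$ iff $M,Y\models\varphi$ for all facets $Y$ with $A\subseteq\chi(X\cap Y)$; and $M\models\varphi$ means truth at all facets. A *logical obstruction* in $\mathcal L_D^+$ to solving $\mathcal{SA}_2$ by $\mathcal{IS}^r$ is a $\varphi\in\mathcal L_D^+$ with $\mathcal I[\mathcal{SA}_2]\models\varphi$ and $\mathcal I[\mathcal{IS}^r]\not\models\varphi$. A *total D-simulation* of $M$ by $M'$ is a relation $S\subseteq\mathcal F(M)\times\mathcal F(M')$ such that: $X\mathrel S X'$ implies $l(X)=l'(X')$; whenever $X\mathrel S X'$ and $Y\in\mathcal F(M)$ there is $Y'\in\mathcal F(M')$ with $Y\mathrel S Y'$ and $\chi(X\cap Y)\subseteq\chi'(X'\cap Y')$; and every $X\in\mathcal F(M)$ is related to some $X'$. *The relations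 $R^{p,q}$ and $S$.* For a vertex $x=(a,i_a,v_a)$ of $\mathcal I[\mathcal{IS}^2]$ write $q\in view(x)$ if $(q,j)\in car(v_a)$ for some $j$. For $p<q$ in $\Pi$ and vertices $x,y$ of $\mathcal I[\mathcal{IS}^2]$, let $x\mathrel{R_0^{p,q}}y$ iff $\{x,y\}$ is a $1$-simplex and ($p\notin view(x)$ or $q\notin view(y)$). Let $x\mathrel{R_{n+1}^{p,q}}y$ iff $x\mathrel{R_n^{p,q}}y$, or there is $z$ with $x\mathrel{R_n^{p,q}}z$, $z\mathrel{R_n^{p,q}}y$ and $\{x,y,z\}$ a $2$-simplex. Put $R^{p,q}=\bigl(\bigcup_n R_n^{p,q}\bigr)\setminus R_0^{p,q}$. For facets of $\mathcal I[\mathcal{IS}^2]$ and $\mathcal I[\mathcal{SA}_2]$, let $\{(a,i_a,v_a)\mid a\in\Pi\}\mathrel S\{(a,i'_a,d_a)\mid a\in\Pi\}$ iff: (1) $i_a=i'_a$ for all $a$; (2) for all $a$ there is $a'$ with $(a',d_a)\in car(v_a)$; (3) for all $a\ne b$ and $p<q$, if $|\{i_0,i_1,i_2\}|=3$ and $(a,i_a,v_a)\mathrel{R^{p,q}}(b,i_b,v_b)$,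 then $d_a\ne i_p$ or $d_b\ne i_q$. **Theorem.** (i) For every $r\ge2$ there is no logical obstruction in $\mathcal L_D^+$ to solving $\mathcal{SA}_2$ by $\mathcal{IS}^r$. (ii) $S$ is a total D-simulation of $\mathcal I[\mathcal{IS}^2]$ by $\mathcal I[\mathcal{SA}_2]$. (iii) For every $r\ge3$ there is a morphism $f:\mathcal I[\mathcal{IS}^r]\to\mathcal I[\mathcal{IS}^2]$ with $f(I[\gamma_1,\dots,\gamma_r])=I[\gamma_1,\gamma_2]$ for all facets $I$ of $\mathcal I$ and all ordered partitions $\gamma_1,\dots,\gamma_r$. -/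

import Mathlib

namespace SimplicialEpistemic

/-! ### Chromatic simplicial complexes

`Ag` is the finite set of agents (processes, colours).  A complex lives on an ambient type `α`; its
vertices are the `v : α` lying in some simplex, so that every vertex spans a simplex. -/

/-- A chromatic simplicial complex: the colouring is injective on every simplex. -/
structure ChromaticComplex (Ag α : Type) extends PreAbstractSimplicialComplex α where
  /-- the colouring (only its values on vertices matter) -/
  χ : α → Ag
  chromatic : ∀ X ∈ faces, Set.InjOn χ (X : Set α)

namespace ChromaticComplex

variable {Ag α : Type}

/-- The facets: simplices maximal with respect to inclusion. -/
def facets (C : ChromaticComplex Ag α) : Set (Finset α) := {X | Maximal (· ∈ C.faces) X}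

/-- The vertices. -/
def vertices (C : ChromaticComplex Ag α) : Set α := {v | ∃ X ∈ C.faces, v ∈ X}

/-- `χ(X ∩ Y)`, the set of colours of the common vertices of `X` and `Y`. -/
def common (C : ChromaticComplex Ag α) (X Y : Finset α) : Set Ag :=
  C.χ '' ((X : Set α) ∩ (Y : Set α))

/-- Indistinguishability `X ∼_a Y`. -/
def Indist (C : ChromaticComplex Ag α) (a : Ag) (X Y : Finset α) : Prop := a ∈ C.common X Y

/-- Pure of dimension `|Ag| - 1`: every facet has exactly `|Ag|` vertices. -/
def IsPure [Fintype Ag] (C : ChromaticComplex Ag α) : Prop :=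
  ∀ X ∈ C.facets, X.card = Fintype.card Ag

end ChromaticComplex

/-- `X` has exactly one vertex of each colour. -/
def IsColorful {Ag α : Type} (χ : α → Ag) (X : Finset α) : Prop := ∀ a, ∃! v, v ∈ X ∧ χ v = a

theorem IsColorful.injOn {Ag α : Type} {χ : α → Ag} {X : Finset α} (h : IsColorful χ X) :
    Set.InjOn χ (X : Set α) := fun _ hv w hw e =>
  (h (χ w)).unique ⟨hv, e⟩ ⟨hw, rfl⟩

theorem IsColorful.card {Ag α : Type} [Fintype Ag] {χ : α → Ag} {X : Finset α}
    (h : IsColorful χ X) : X.card = Fintype.card Ag := by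
  refine Finset.card_bij (t := Finset.univ) (fun v _ => χ v) (fun _ _ => Finset.mem_univ _)
    (fun v hv w hw e => h.injOn hv hw e) (fun a _ => ?_)
  obtain ⟨v, hv, -⟩ := h a
  exact ⟨v, hv.1, hv.2⟩

theorem ChromaticComplex.IsPure.colorful {Ag α : Type} [Fintype Ag] {C : ChromaticComplex Ag α}
    (h : C.IsPure) {X : Finset α} (hX : X ∈ C.facets) : IsColorful C.χ X := by
  classical
  have hinj := C.chromatic X hX.prop
  have himg : X.image C.χ = Finset.univ := by
    apply Finset.eq_univ_of_card
    rw [Finset.card_image_of_injOn hinj, h X hX]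
  intro a
  have ha : a ∈ X.image C.χ := by rw [himg]; exact Finset.mem_univ a
  obtain ⟨v, hv, rfl⟩ := Finset.mem_image.mp ha
  exact ⟨v, ⟨hv, rfl⟩, fun w hw => hinj hw.1 hv hw.2⟩

/-- The chromatic complex whose facets are the members of `F`, each of which has one vertex of each
colour: its simplices are the nonempty subsets of members of `F`. -/
def ofFacets {Ag α : Type} (χ : α → Ag) (F : Set (Finset α)) (hF : ∀ X ∈ F, IsColorful χ X) :
    ChromaticComplex Ag α where
  faces := {Y | Y.Nonempty ∧ ∃ X ∈ F, Y ⊆ X}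
  isRelLowerSet_faces := fun _ hY =>
    ⟨hY.1, fun _ hZ hne => ⟨hne, hY.2.imp fun _ h => ⟨h.1, hZ.trans h.2⟩⟩⟩
  χ := χ
  chromatic := by
    rintro Y ⟨-, X, hX, hYX⟩
    exact (hF X hX).injOn.mono (by exact_mod_cast hYX)

theorem mem_of_mem_facets_ofFacets {Ag α : Type} {χ : α → Ag} {F : Set (Finset α)}
    {hF : ∀ X ∈ F, IsColorful χ X} {X : Finset α} (hX : X ∈ (ofFacets χ F hF).facets) :
    X ∈ F := by
  obtain ⟨⟨hne, Z, hZ, hXZ⟩, hmax⟩ := hX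
  have hZX : Z ≤ X := hmax (y := Z) ⟨hne.mono hXZ, Z, hZ, subset_rfl⟩ hXZ
  rwa [Finset.Subset.antisymm hXZ hZX]

theorem ofFacets_isPure {Ag α : Type} [Fintype Ag] (χ : α → Ag) (F : Set (Finset α))
    (hF : ∀ X ∈ F, IsColorful χ X) : (ofFacets χ F hF).IsPure := fun X hX =>
  (hF X (mem_of_mem_facets_ofFacets hX)).card

/-- For nonempty `Ag`, the facets of `ofFacets χ F` are exactly the members of `F`. -/
theorem mem_facets_ofFacets {Ag α : Type} [Fintype Ag] [Nonempty Ag] {χ : α → Ag}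
    {F : Set (Finset α)} {hF : ∀ X ∈ F, IsColorful χ X} {X : Finset α} :
    X ∈ (ofFacets χ F hF).facets ↔ X ∈ F := by
  refine ⟨mem_of_mem_facets_ofFacets, fun hX => ⟨⟨?_, X, hX, subset_rfl⟩, ?_⟩⟩
  · rw [← Finset.card_pos, (hF X hX).card]
    exact Fintype.card_pos
  · rintro Y ⟨-, Z, hZ, hYZ⟩ hXY
    have : X = Z := Finset.eq_of_subset_of_card_le (Finset.Subset.trans hXY hYZ)
      (by rw [(hF X hX).card, (hF Z hZ).card])
    rw [this]
    exact hYZ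

/-- The set `{(a, f a) | a ∈ Ag}`. -/
def graph {Ag β : Type} [Fintype Ag] (f : Ag → β) : Finset (Ag × β) :=
  Finset.univ.map ⟨fun a => (a, f a), fun _ _ h => congrArg Prod.fst h⟩

theorem isColorful_graph {Ag β : Type} [Fintype Ag] (f : Ag → β) :
    IsColorful Prod.fst (graph f) := by
  intro a
  refine ⟨(a, f a), ⟨Finset.mem_map.mpr ⟨a, Finset.mem_univ a, rfl⟩, rfl⟩, ?_⟩
  rintro ⟨b, y⟩ ⟨h, rfl⟩
  obtain ⟨c, -, hc⟩ := Finset.mem_map.mp h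
  cases hc
  rfl

/-! ### Simplicial models and morphisms -/

/-- The atomic proposition `ip_a^v`. -/
structure Atom (Ag Vin : Type) where
  agent : Ag
  value : Vin

/-- A simplicial model: a pure `(|Ag| - 1)`-dimensional chromatic complex whose vertices carry
labels `l v ⊆ At_{χ v}`. -/
structure SimplicialModel (Ag Vin α : Type) [Fintype Ag] extends ChromaticComplex Ag α where
  l : α → Set (Atom Ag Vin)
  pure : toChromaticComplex.IsPure
  label : ∀ v ∈ toChromaticComplex.vertices, ∀ p ∈ l v, p.agent = χ v

/-- The labelling `l(X)` of a set of vertices. -/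
def SimplicialModel.labels {Ag Vin α : Type} [Fintype Ag] (M : SimplicialModel Ag Vin α)
    (X : Finset α) : Set (Atom Ag Vin) := ⋃ v ∈ X, M.l v

/-- `f` is a morphism of simplicial models: it maps simplices to simplices and preserves the
colours and labels of vertices. -/
structure IsMorphism {Ag Vin α β : Type} [Fintype Ag] (M : SimplicialModel Ag Vin α)
    (M' : SimplicialModel Ag Vin β) (f : α → β) : Prop where
  map_simplex : ∀ X ∈ M.faces, ∃ Y ∈ M'.faces, (Y : Set β) = f '' (X : Set α)
  map_color : ∀ v ∈ M.vertices, M'.χ (f v) = M.χ v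
  map_label : ∀ v ∈ M.vertices, M'.l (f v) = M.l v

/-- The input simplicial model: the vertices are all pairs `(a, v)`, and a nonempty finite set of
vertices is a simplex iff it has at most one vertex of each colour. -/
def inputModel (Ag Vin : Type) [Fintype Ag] : SimplicialModel Ag Vin (Ag × Vin) where
  faces := {X | X.Nonempty ∧ Set.InjOn Prod.fst (X : Set (Ag × Vin))}
  isRelLowerSet_faces := fun _ hX => ⟨hX.1, fun _ hY hne => ⟨hne, hX.2.mono (by exact_mod_cast hY)⟩⟩
  χ := Prod.fst
  chromatic := fun _ hX => hX.2
  l := fun v => {⟨v.1, v.2⟩}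
  pure := by
    classical
    rintro X ⟨⟨hne, hinj⟩, hmax⟩
    obtain ⟨⟨b, w⟩, hbw⟩ := hne
    have himg : X.image Prod.fst = Finset.univ := by
      rw [Finset.eq_univ_iff_forall]
      intro a
      by_contra ha
      have hX' : insert (a, w) X ≤ X := by
        refine hmax (y := insert (a, w) X) ⟨Finset.insert_nonempty _ _, ?_⟩
          (Finset.subset_insert _ _)
        rw [Finset.coe_insert, Set.injOn_insert]
        · refine ⟨hinj, ?_⟩
          rintro ⟨v, hv, e⟩
          exact ha (Finset.mem_image.mpr ⟨v, hv, e⟩)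
        · intro h
          exact ha (Finset.mem_image.mpr ⟨_, h, rfl⟩)
      exact ha (Finset.mem_image.mpr ⟨_, hX' (Finset.mem_insert_self _ _), rfl⟩)
    rw [← Finset.card_image_of_injOn hinj, himg, Finset.card_univ]
  label := by
    rintro v - p rfl
    rfl

/-! ### Epistemic formulas -/

/-- The language `L_K`. -/
inductive FormulaK (Ag Vin : Type) where
  | atom (p : Atom Ag Vin)
  | neg (φ : FormulaK Ag Vin)
  | and (φ ψ : FormulaK Ag Vin)
  | K (a : Ag) (φ : FormulaK Ag Vin)

/-- Truth of an `L_K` formula at a facet. -/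
def FormulaK.Sat {Ag Vin α : Type} [Fintype Ag] (M : SimplicialModel Ag Vin α) :
    FormulaK Ag Vin → Finset α → Prop
  | .atom p, X => p ∈ M.labels X
  | .neg φ, X => ¬ φ.Sat M X
  | .and φ ψ, X => φ.Sat M X ∧ ψ.Sat M X
  | .K a φ, X => ∀ Y ∈ M.facets, M.Indist a Y X → φ.Sat M Y

namespace FormulaK

variable {Ag Vin : Type}

/-- Disjunction, as an abbreviation. -/
def or (φ ψ : FormulaK Ag Vin) : FormulaK Ag Vin := .neg (.and (.neg φ) (.neg ψ))

/-- A contradiction `p ∧ ¬ p`: the empty disjunction. -/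
def bot [Inhabited Ag] [Inhabited Vin] : FormulaK Ag Vin :=
  .and (.atom ⟨default, default⟩) (.neg (.atom ⟨default, default⟩))

/-- The conjunction of a finite family of formulas. -/
noncomputable def bigAnd {ι : Type} [Inhabited Ag] [Inhabited Vin] (s : Finset ι)
    (φ : ι → FormulaK Ag Vin) : FormulaK Ag Vin :=
  s.toList.foldr (fun x ψ => .and (φ x) ψ) (.neg bot)

/-- The disjunction of a finite family of formulas. -/
noncomputable def bigOr {ι : Type} [Inhabited Ag] [Inhabited Vin] (s : Finset ι)
    (φ : ι → FormulaK Ag Vin) : FormulaK Ag Vin :=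
  s.toList.foldr (fun x ψ => .or (φ x) ψ) bot

end FormulaK

/-- The language `L_D`, with the distributed knowledge operators `D_A` for `A ⊆ Ag`. -/
inductive FormulaD (Ag Vin : Type) where
  | atom (p : Atom Ag Vin)
  | neg (φ : FormulaD Ag Vin)
  | and (φ ψ : FormulaD Ag Vin)
  | D (A : Set Ag) (φ : FormulaD Ag Vin)

/-- Truth of an `L_D` formula at a facet. -/
def FormulaD.Sat {Ag Vin α : Type} [Fintype Ag] (M : SimplicialModel Ag Vin α) :
    FormulaD Ag Vin → Finset α → Prop
  | .atom p, X => p ∈ M.labels X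
  | .neg φ, X => ¬ φ.Sat M X
  | .and φ ψ, X => φ.Sat M X ∧ ψ.Sat M X
  | .D A φ, X => ∀ Y ∈ M.facets, A ⊆ M.common X Y → φ.Sat M Y

/-- Disjunction, as an abbreviation. -/
def FormulaD.or {Ag Vin : Type} (φ ψ : FormulaD Ag Vin) : FormulaD Ag Vin :=
  .neg (.and (.neg φ) (.neg ψ))

/-- The positive fragment `L_D^+` of `L_D`:
`φ ::= p | ¬ p | φ ∨ φ | φ ∧ φ | D_A φ`. -/
inductive FormulaD.IsPositive {Ag Vin : Type} : FormulaD Ag Vin → Prop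
  | atom (p : Atom Ag Vin) : IsPositive (.atom p)
  | negAtom (p : Atom Ag Vin) : IsPositive (.neg (.atom p))
  | or {φ ψ : FormulaD Ag Vin} : IsPositive φ → IsPositive ψ → IsPositive (φ.or ψ)
  | and {φ ψ : FormulaD Ag Vin} : IsPositive φ → IsPositive ψ → IsPositive (.and φ ψ)
  | D (A : Set Ag) {φ : FormulaD Ag Vin} : IsPositive φ → IsPositive (.D A φ)

/-- `M ⊨ φ`: truth at all facets. -/
def FormulaD.Valid {Ag Vin α : Type} [Fintype Ag] (M : SimplicialModel Ag Vin α)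
    (φ : FormulaD Ag Vin) : Prop := ∀ X ∈ M.facets, φ.Sat M X

/-! ### Action models and product update -/

/-- A simplicial action model (the precondition matters only on facets). -/
structure ActionModel (Ag Vin α : Type) [Fintype Ag] extends ChromaticComplex Ag α where
  pre : Finset α → FormulaK Ag Vin
  pure : toChromaticComplex.IsPure

/-- `X ×_Ag T`: the pairs of a vertex of `X` and a vertex of `T` of the same colour. -/
def colorProd {Ag α β : Type} [DecidableEq Ag] (χ : α → Ag) (χ' : β → Ag) (X : Finset α)
    (T : Finset β) : Finset (α × β) := (X ×ˢ T).filter fun v => χ v.1 = χ' v.2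

theorem isColorful_colorProd {Ag α β : Type} [DecidableEq Ag] {χ : α → Ag} {χ' : β → Ag}
    {X : Finset α} {T : Finset β} (hX : IsColorful χ X) (hT : IsColorful χ' T) :
    IsColorful (fun v : α × β => χ v.1) (colorProd χ χ' X T) := by
  intro a
  obtain ⟨x, ⟨hx, rfl⟩, hx'⟩ := hX a
  obtain ⟨t, ⟨ht, hxt⟩, ht'⟩ := hT (χ x)
  refine ⟨(x, t), ⟨by simp [colorProd, hx, ht, hxt], rfl⟩, ?_⟩
  rintro ⟨y, u⟩ ⟨h, e⟩
  obtain ⟨⟨hy, hu⟩, hyu⟩ : (y ∈ X ∧ u ∈ T) ∧ χ y = χ' u := by simpa [colorProd] using h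
  have e' : χ y = χ x := e
  rw [hx' y ⟨hy, e'⟩, ht' u ⟨hu, hyu.symm.trans e'⟩]

/-- The product update model `M[A]`. -/
def productUpdate {Ag Vin α β : Type} [Fintype Ag] [DecidableEq Ag] (M : SimplicialModel Ag Vin α)
    (A : ActionModel Ag Vin β) : SimplicialModel Ag Vin (α × β) where
  toChromaticComplex := ofFacets (fun v => M.χ v.1)
    {Z | ∃ X ∈ M.facets, ∃ T ∈ A.facets, (A.pre T).Sat M X ∧ Z = colorProd M.χ A.χ X T}
    (by
      rintro Z ⟨X, hX, T, hT, -, rfl⟩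
      exact isColorful_colorProd (M.pure.colorful hX) (A.pure.colorful hT))
  l := fun v => M.l v.1
  pure := ofFacets_isPure _ _ _
  label := by
    rintro ⟨m, t⟩ ⟨Y, ⟨-, Z, ⟨X, hX, T, hT, -, rfl⟩, hYZ⟩, hv⟩ p hp
    have hm : m ∈ X ∧ t ∈ T ∧ M.χ m = A.χ t := by
      simpa [colorProd, and_assoc] using hYZ hv
    exact M.label m ⟨X, hX.prop, hm.1⟩ p hp

/-- `φ` is a logical obstruction in `L_D^+` to the solvability of `T` by `P`, for the input
model `I`: a positive formula with `I[T] ⊨ φ` and `I[P] ⊭ φ`. -/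
def IsLogicalObstruction {Ag Vin α β γ : Type} [Fintype Ag] [DecidableEq Ag]
    (I : SimplicialModel Ag Vin α) (T : ActionModel Ag Vin β) (P : ActionModel Ag Vin γ)
    (φ : FormulaD Ag Vin) : Prop :=
  φ.IsPositive ∧ φ.Valid (productUpdate I T) ∧ ¬ φ.Valid (productUpdate I P)

/-- A D-simulation of `M` by `M'`. -/
structure IsDSimulation {Ag Vin α β : Type} [Fintype Ag] (M : SimplicialModel Ag Vin α)
    (M' : SimplicialModel Ag Vin β) (R : Finset α → Finset β → Prop) : Prop where
  facet : ∀ X X', R X X' → X ∈ M.facets ∧ X' ∈ M'.facets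
  atom : ∀ X X', R X X' → M.labels X = M'.labels X'
  forth : ∀ X ∈ M.facets, ∀ Y ∈ M.facets, ∀ X' ∈ M'.facets, R X X' →
    ∃ Y' ∈ M'.facets, R Y Y' ∧ M.common X Y ⊆ M'.common X' Y'

/-- A total D-simulation of `M` by `M'`. -/
structure IsTotalDSimulation {Ag Vin α β : Type} [Fintype Ag] (M : SimplicialModel Ag Vin α)
    (M' : SimplicialModel Ag Vin β) (R : Finset α → Finset β → Prop) : Prop
    extends IsDSimulation M M' R where
  total : ∀ X ∈ M.facets, ∃ X' ∈ M'.facets, R X X'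

/-! ### The `k`-set agreement task -/

/-- `k`-set agreement, with `V^out = V^in`: the facets are `{(a, d a) | a ∈ Ag}` for
`d : Ag → V^in` with at most `k` values, and the precondition of such a facet is
`⋀_a ⋁_b ip_b^{d a}` (the conjunction is indexed by the vertices `(a, d a)` of the facet). -/
noncomputable def setAgreement (Ag Vin : Type) [Fintype Ag] [Inhabited Ag] [Inhabited Vin]
    [DecidableEq Vin] (k : ℕ) : ActionModel Ag Vin (Ag × Vin) where
  toChromaticComplex := ofFacets Prod.fst
    {T | ∃ d : Ag → Vin, (Finset.univ.image d).card ≤ k ∧ T = graph d}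
    (by
      rintro _ ⟨d, -, rfl⟩
      exact isColorful_graph d)
  pre := fun T => FormulaK.bigAnd T fun v =>
    FormulaK.bigOr Finset.univ fun b : Ag => .atom ⟨b, v.2⟩
  pure := ofFacets_isPure _ _ _

/-! ### Iterated immediate snapshot -/

/-- An ordered partition: a sequence `∅ ≠ C_1 ⊊ C_2 ⊊ ⋯ ⊊ C_l = Ag`. -/
structure OrderedPartition (Ag : Type) [Fintype Ag] where
  blocks : List (Finset Ag)
  nonempty : ∀ C ∈ blocks, C.Nonempty
  chain : blocks.IsChain (· ⊂ ·)
  last : blocks.getLast? = some Finset.univ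

/-- `C_{min {j | a ∈ C_j}}`, the first block containing `a` (there always is one, as the last block
is `Ag`). -/
def OrderedPartition.block {Ag : Type} [Fintype Ag] [DecidableEq Ag] (γ : OrderedPartition Ag)
    (a : Ag) : Finset Ag := (γ.blocks.find? fun C => decide (a ∈ C)).getD Finset.univ

/-- The possible views.  An element `{(p, v_p) | p ∈ P}` of `Views^{r+1}`, where `P ⊆ Ag` and
`v_p ∈ Views^r`, is the partial function with domain `P` that sends `p` to `v_p`. -/
def Views (Ag Vin : Type) : ℕ → Type
  | 0 => Vin
  | r + 1 => Ag → Option (Views Ag Vin r)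

/-- `view^r_a(I, γ_1, …, γ_r)`, where `I` is the facet `{(b, i b) | b ∈ Ag}` of the input model. -/
def view {Ag Vin : Type} [Fintype Ag] [DecidableEq Ag] (i : Ag → Vin) :
    (r : ℕ) → (Fin r → OrderedPartition Ag) → Ag → Views Ag Vin r
  | 0, _, a => i a
  | r + 1, γ, a => fun p =>
      if p ∈ (γ (Fin.last r)).block a then some (view i r (fun j => γ j.castSucc) p) else none

/-- The flattening `car` of a view of positive level `r + 1`, as a set of pairs `(p, i_p)`. -/
def car {Ag Vin : Type} : (r : ℕ) → Views Ag Vin (r + 1) → Set (Ag × Vin)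
  | 0, w => {x | w x.1 = some x.2}
  | r + 1, w => {x | ∃ (p : Ag) (v : Views Ag Vin (r + 1)), w p = some v ∧ x ∈ car r v}

/-- The action model `IS^r` of the `r`-iterated immediate snapshot: the facets are
`{(a, i_a, view^r_a(I, γ_1, …, γ_r)) | a ∈ Ag}`, where `I = {(a, i_a) | a ∈ Ag}` is any facet of the
input model, and the precondition of such a facet is `⋀_a ip_a^{i_a}` (the conjunction is indexed
by the vertices `(a, i_a, v_a)` of the facet). -/
noncomputable def snapshot (Ag Vin : Type) [Fintype Ag] [DecidableEq Ag] [Inhabited Ag]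
    [Inhabited Vin] (r : ℕ) : ActionModel Ag Vin (Ag × Vin × Views Ag Vin r) where
  toChromaticComplex := ofFacets Prod.fst
    {T | ∃ i : Ag → Vin, graph i ∈ (inputModel Ag Vin).facets ∧
      ∃ γ : Fin r → OrderedPartition Ag, T = graph fun a => (i a, view i r γ a)}
    (by
      rintro _ ⟨i, -, γ, rfl⟩
      exact isColorful_graph _)
  pre := fun T => FormulaK.bigAnd T fun v => .atom ⟨v.1, v.2.1⟩
  pure := ofFacets_isPure _ _ _

/-- The type of the vertices `((a, i_a), (a, i_a, v_a))` of `I[IS^r]`. -/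
abbrev SnapVertex (Ag Vin : Type) (r : ℕ) : Type := (Ag × Vin) × (Ag × Vin × Views Ag Vin r)

/-- The type of the vertices `((a, i_a), (a, d_a))` of `I[SA_k]`. -/
abbrev AgreeVertex (Ag Vin : Type) : Type := (Ag × Vin) × (Ag × Vin)

/-- The vertex of `I[IS^r]` written `(a, i_a, v_a)`. -/
def snapVertex {Ag Vin : Type} {r : ℕ} (a : Ag) (x : Vin) (v : Views Ag Vin r) :
    SnapVertex Ag Vin r := ((a, x), (a, x, v))

/-- `{(a, i_a, v_a) | a ∈ Ag}`, as a set of vertices of `I[IS^r]`. -/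
def snapFacet {Ag Vin : Type} [Fintype Ag] {r : ℕ} (i : Ag → Vin) (v : Ag → Views Ag Vin r) :
    Finset (SnapVertex Ag Vin r) :=
  Finset.univ.map ⟨fun a => snapVertex a (i a) (v a), fun _ _ h => congrArg (fun y => y.1.1) h⟩

/-- `{(a, i_a, d_a) | a ∈ Ag}`, as a set of vertices of `I[SA_k]`. -/
def agreeFacet {Ag Vin : Type} [Fintype Ag] (i d : Ag → Vin) : Finset (AgreeVertex Ag Vin) :=
  Finset.univ.map ⟨fun a => ((a, i a), (a, d a)), fun _ _ h => congrArg (fun y => y.1.1) h⟩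

/-- The facet `I[γ_1, …, γ_r]` of `I[IS^r]`, where `I = {(a, i a) | a ∈ Ag}`. -/
def runFacet {Ag Vin : Type} [Fintype Ag] [DecidableEq Ag] (i : Ag → Vin) {r : ℕ}
    (γ : Fin r → OrderedPartition Ag) : Finset (SnapVertex Ag Vin r) := snapFacet i (view i r γ)

/-! ### Three processes `0, 1, 2` with input values `0, 1, 2` -/

/-- The input model. -/
abbrev inputThree : SimplicialModel (Fin 3) (Fin 3) (Fin 3 × Fin 3) := inputModel (Fin 3) (Fin 3)

/-- `I[IS^r]`. -/
noncomputable abbrev inputIS (r : ℕ) :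
    SimplicialModel (Fin 3) (Fin 3) (SnapVertex (Fin 3) (Fin 3) r) :=
  productUpdate inputThree (snapshot (Fin 3) (Fin 3) r)

/-- `I[SA_k]`. -/
noncomputable abbrev inputSA (k : ℕ) :
    SimplicialModel (Fin 3) (Fin 3) (AgreeVertex (Fin 3) (Fin 3)) :=
  productUpdate inputThree (setAgreement (Fin 3) (Fin 3) k)

/-- `q ∈ view(x)` for a vertex `x = (p, i_p, v_p)` of `I[IS^2]`: some pair `(q, i_q)` lies in
`car(v_p)`. -/
def InView (q : Fin 3) (x : SnapVertex (Fin 3) (Fin 3) 2) : Prop :=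
  ∃ y : Fin 3, (q, y) ∈ car 1 x.2.2.2

/-- The relations `R_n^{p,q}` on vertices of `I[IS^2]`. -/
def relN (p q : Fin 3) : ℕ → SnapVertex (Fin 3) (Fin 3) 2 → SnapVertex (Fin 3) (Fin 3) 2 → Prop
  | 0, x, y => (∃ e ∈ (inputIS 2).faces, e.card = 2 ∧ (e : Set _) = {x, y}) ∧
      (¬ InView p x ∨ ¬ InView q y)
  | n + 1, x, y => relN p q n x y ∨ ∃ z, relN p q n x z ∧ relN p q n z y ∧
      ∃ t ∈ (inputIS 2).faces, t.card = 3 ∧ (t : Set _) = {x, y, z}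

/-- The relation `R^{p,q} = (⋃_n R_n^{p,q}) \ R_0^{p,q}`. -/
def rel (p q : Fin 3) (x y : SnapVertex (Fin 3) (Fin 3) 2) : Prop :=
  (∃ n, relN p q n x y) ∧ ¬ relN p q 0 x y

/-- The relation `S` between facets of `I[IS^2]` and facets of `I[SA_2]`. -/
def simS (X : Finset (SnapVertex (Fin 3) (Fin 3) 2)) (X' : Finset (AgreeVertex (Fin 3) (Fin 3))) :
    Prop :=
  X ∈ (inputIS 2).facets ∧ X' ∈ (inputSA 2).facets ∧
    ∃ (i : Fin 3 → Fin 3) (v : Fin 3 → Views (Fin 3) (Fin 3) 2) (i' d : Fin 3 → Fin 3),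
      X = snapFacet i v ∧ X' = agreeFacet i' d ∧
      (∀ a, i a = i' a) ∧
      (∀ a, ∃ a', (a', d a) ∈ car 1 (v a)) ∧
      (∀ a b p q : Fin 3, a ≠ b → p < q → (Finset.univ.image i).card = 3 →
        rel p q (snapVertex a (i a) (v a)) (snapVertex b (i b) (v b)) →
        d a ≠ i p ∨ d b ≠ i q)

end SimplicialEpistemic

open SimplicialEpistemic

namespace SimplicialEpistemic

/-! Positive formulas pull back along a total D-simulation (`IsTotalDSimulation.valid`), so such a
simulation of `I[IS^r]` by `I[SA_2]` excludes every obstruction. Each process sees its own past,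
hence the first two rounds can be read off from later views. This gives a morphism to `I[IS^2]`
(`isMorphism_truncVertex`), and a simulation composes with a morphism, so everything rests on `S`.

The relation `R^{p,q}` collects the edges `x y` on which `x` cannot decide the input of `p` while
`y` decides that of `q`, although both inputs are visible. On a triangle `x y z` with at most two
decided values, `z` would have to decide one of these two inputs. If the input of `p` is excluded by
`z y` and that of `q` by `x z`, then the pair is excluded on `x y`: this is the recursive clause of
`R^{p,q}`.

`S` constrains only vertices and edges. Two distinct facets share a proper part, so the forth
condition asks that allowed decisions on a proper part of a facet extend to the facet
(`exists_decides_extension`). This follows from extension from a vertex to an edge and from an edge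
to a triangle. Constraints carry over between facets because an edge in `R^{p,q}` sees all three
inputs (`sees_of_shapeRel`).

Which inputs are visible, and `R^{p,q}` itself, depend only on colours and on nine-bit shapes of
views. A closed form of `R^{p,q}` on shapes (`rel_vertexThree_iff`) turns the combinatorics into
checks over the 13 × 13 pairs of rounds. -/

/-! ### The thirteen ordered partitions of three processes -/

/-- The strictly increasing chains of nonempty sets of processes that end in the whole set. -/
def chainThree : Fin 13 → List (Finset (Fin 3)) :=
  ![[{0, 1, 2}],
    [{0}, {0, 1, 2}], [{1}, {0, 1, 2}], [{2}, {0, 1, 2}],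
    [{0, 1}, {0, 1, 2}], [{0, 2}, {0, 1, 2}], [{1, 2}, {0, 1, 2}],
    [{0}, {0, 1}, {0, 1, 2}], [{0}, {0, 2}, {0, 1, 2}],
    [{1}, {0, 1}, {0, 1, 2}], [{1}, {1, 2}, {0, 1, 2}],
    [{2}, {0, 2}, {0, 1, 2}], [{2}, {1, 2}, {0, 1, 2}]]

theorem chainThree_nonempty : ∀ k, ∀ C ∈ chainThree k, C.Nonempty := by decide +kernel

theorem chainThree_isChain : ∀ k, (chainThree k).IsChain (· ⊂ ·) := by decide +kernel

theorem chainThree_last : ∀ k, (chainThree k).getLast? = some Finset.univ := by decide +kernel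

/-- The ordered partition with the chain `chainThree k`. -/
def partitionThree (k : Fin 13) : OrderedPartition (Fin 3) :=
  ⟨chainThree k, chainThree_nonempty k, chainThree_isChain k, chainThree_last k⟩

theorem OrderedPartition.ext_blocks {Ag : Type} [Fintype Ag] {γ δ : OrderedPartition Ag}
    (h : γ.blocks = δ.blocks) : γ = δ := by
  cases γ; cases δ; simpa using h

theorem exists_chainThree_of_ssubset : ∀ C : Finset (Fin 3), C.Nonempty → C ⊂ Finset.univ →
    ∃ k, chainThree k = [C, Finset.univ] := by decide +kernel

theorem exists_chainThree_of_ssubset_ssubset : ∀ C D : Finset (Fin 3), C.Nonempty → C ⊂ D →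
    D ⊂ Finset.univ → ∃ k, chainThree k = [C, D, Finset.univ] := by decide +kernel

theorem exists_partitionThree (γ : OrderedPartition (Fin 3)) : ∃ k, γ = partitionThree k := by
  suffices h : ∃ k, chainThree k = γ.blocks from
    h.imp fun k hk => OrderedPartition.ext_blocks hk.symm
  obtain ⟨bl, hne, hc, hl⟩ := γ
  match bl, hne, hc, hl with
  | [C], _, _, hl =>
    obtain rfl : C = Finset.univ := by simpa using hl
    exact ⟨0, rfl⟩
  | [C, D], hne, hc, hl =>
    obtain rfl : D = Finset.univ := by simpa using hl
    exact exists_chainThree_of_ssubset C (hne C (by simp)) (by simpa using hc)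
  | [C, D, E], hne, hc, hl =>
    obtain rfl : E = Finset.univ := by simpa using hl
    simp only [List.isChain_cons_cons] at hc
    exact exists_chainThree_of_ssubset_ssubset C D (hne C (by simp)) hc.1 hc.2.1
  -- Cardinalities grow strictly along the chain, so a fourth set would have at least four elements.
  | C :: D :: E :: F :: t, hne, hc, _ =>
    simp only [List.isChain_cons_cons] at hc
    have h0 := (hne C (by simp)).card_pos
    have h1 := Finset.card_lt_card hc.1
    have h2 := Finset.card_lt_card hc.2.1
    have h3 := Finset.card_lt_card hc.2.2.1
    have h4 := F.card_le_univ
    simp only [Fintype.card_fin] at h4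
    omega

/-- The blocks of `partitionThree k`, encoded bitwise: bit `3 a + q` says whether `q` lies in the
block of `a`. -/
def blockCode : Fin 13 → ℕ :=
  ![511, 505, 471, 319, 475, 381, 439, 473, 377, 467, 407, 317, 311]

/-- Whether process `a` sees process `q` in a round scheduled by `partitionThree k`. -/
def cell (k : Fin 13) (a q : Fin 3) : Bool := (blockCode k).testBit (3 * a.val + q.val)

theorem mem_block_partitionThree :
    ∀ k a q, q ∈ (partitionThree k).block a ↔ cell k a q = true := by decide +kernel

/-! ### Shapes of views

The shape of a view of level two records which first-round values of which processes it contains.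
It is encoded bitwise: bit `3 p + q` says whether the view contains the input value of `q` inside
the first-round view of `p`. -/

/-- The shape of the view of `a` after the rounds `partitionThree k`, `partitionThree l`. -/
def shapeThree (k l : Fin 13) (a : Fin 3) : ℕ :=
  -- The masks 7, 56 and 448 select the three-bit rows of the first-round views of processes 0, 1
  -- and 2.
  blockCode k &&& ((cell l a 0).toNat * 7 + (cell l a 1).toNat * 56 + (cell l a 2).toNat * 448)

/-- Whether process `q` occurs in a view of shape `m`. -/
def sees (m q : ℕ) : Bool := m &&& (73 <<< q) != 0

/-- Whether a view of shape `m` contains the first-round view `{r}` of `r`. -/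
def seesSolo (m r : ℕ) : Bool := (m >>> (3 * r)) &&& 7 == 1 <<< r

/-- The shape that consists of the first-round view `{q, r}` of `q`, where `r` is the third
process. -/
def pairShape (p q : ℕ) : ℕ := (1 <<< q + 1 <<< (3 - p - q)) <<< (3 * q)

/-- The shape that consists of the first-round views `{q, r}` of `q` and `{r}` of `r`, where `r` is
the third process. -/
def edgeShape (p q : ℕ) : ℕ := pairShape p q + 1 <<< (4 * (3 - p - q))

/-- The shape that consists of the first-round views `{p, q, r}` of `p`, `{q, r}` of `q` and `{r}`
of `r`, where `r` is the third process. -/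
def fullShape (p q : ℕ) : ℕ := edgeShape p q + 7 <<< (3 * p)

/-- The edges of `R_s^{p,q}` outside `R_0^{p,q}`, up to the duality that exchanges `p` with `q` and
the two ends of the edge.  For `s = 1` these are edges between a `p`-vertex and a `q`-vertex which
both contain the solo first-round view of the third process; the other ones contain a vertex with a
view of shape `fullShape p q`. -/
def derivedEdge (s p q a m b n : ℕ) : Bool :=
  Nat.blt 0 s && (a == p && b == q || a == q && b == p) &&
      seesSolo m (3 - p - q) && seesSolo n (3 - p - q) ||
  m == fullShape p q &&
    (a == p && (b == q && Nat.blt 2 s && n == pairShape p q ||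
        b == 3 - p - q && (Nat.blt 1 s && n == edgeShape p q || Nat.blt 3 s && n == fullShape p q))
      || a == q && b == 3 - p - q && Nat.blt 4 s && n == fullShape p q)

/-- The relation `R_s^{p,q}` between the vertices of colours `a`, `b` and shapes `m`, `n`. -/
def shapeStage (s p q a m b n : ℕ) : Bool :=
  !sees m p || !sees n q || derivedEdge s p q a m b n || derivedEdge s q p b n a m

/-- The relation `R^{p,q}` between the vertices of colours `a`, `b` and shapes `m`, `n`. -/
def shapeRel (p q a m b n : ℕ) : Bool := sees m p && sees n q && shapeStage 5 p q a m b n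

/-- The stage enters `derivedEdge` only through lower bounds that are at most 5, so stage 5 contains
all the others. -/
theorem shapeRel_of_shapeStage {s p q a m b n : ℕ} (hp : sees m p) (hq : sees n q)
    (h : shapeStage s p q a m b n) : shapeRel p q a m b n := by
  have mono : ∀ p q a m b n, derivedEdge s p q a m b n → derivedEdge 5 p q a m b n := by
    intro p q a m b n h
    simp only [derivedEdge, Bool.or_eq_true, Bool.and_eq_true, Nat.blt_eq] at h ⊢
    grind
  simp only [shapeRel, shapeStage, hp, hq, Bool.not_true, Bool.false_or, Bool.true_and,
    Bool.or_eq_true] at h ⊢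
  exact h.imp (mono _ _ _ _ _ _) (mono _ _ _ _ _ _)

/-- Soundness of the closed form: every new edge of a stage comes from a triangle of the previous
one. Changing only the second round, and keeping what `a` and `b` see in it, fixes their vertices.
The third colour is `-(a + b)`, as the colours sum to zero in `Fin 3`. -/
theorem exists_triangle_of_shapeRel : ∀ k l : Fin 13, ∀ p q a b : Fin 3, p < q → a ≠ b →
    shapeRel p q a (shapeThree k l a) b (shapeThree k l b) → ∀ s : Fin 5,
    shapeStage (s.val + 1) p q a (shapeThree k l a) b (shapeThree k l b) →
    shapeStage s.val p q a (shapeThree k l a) b (shapeThree k l b) ∨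
    ∃ l', (∀ x, cell l' a x = cell l a x) ∧ (∀ x, cell l' b x = cell l b x) ∧
      shapeStage s.val p q a (shapeThree k l' a)
        (-(a + b) : Fin 3) (shapeThree k l' (-(a + b))) ∧
      shapeStage s.val p q (-(a + b) : Fin 3) (shapeThree k l' (-(a + b)))
        b (shapeThree k l' b) := by
  decide +kernel

/-- Completeness of the closed form: stage 5 is closed under the triangle rule, so the iteration
stabilises there. -/
theorem shapeStage_trans : ∀ k l : Fin 13, ∀ p q a b : Fin 3, p < q → a ≠ b →
    shapeStage 5 p q a (shapeThree k l a) (-(a + b) : Fin 3) (shapeThree k l (-(a + b))) →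
    shapeStage 5 p q (-(a + b) : Fin 3) (shapeThree k l (-(a + b))) b (shapeThree k l b) →
    shapeStage 5 p q a (shapeThree k l a) b (shapeThree k l b) := by
  decide +kernel

/-- Together with `sees_self`, this means that an edge of `R^{p,q}` determines all three inputs, and
in particular whether they are distinct. -/
theorem sees_of_shapeRel : ∀ k l : Fin 13, ∀ p q a b : Fin 3, p < q → a ≠ b →
    shapeRel p q a (shapeThree k l a) b (shapeThree k l b) →
      sees (shapeThree k l a) (-(a + b) : Fin 3) ∨ sees (shapeThree k l b) (-(a + b) : Fin 3) := by
  decide +kernel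

theorem sees_self : ∀ k l : Fin 13, ∀ a : Fin 3, sees (shapeThree k l a) a := by
  decide +kernel

/-- The mask `73 = 1 + 8 + 64` in `sees` selects one column, that is, the bit of `q` in each of the
three rows. -/
theorem sees_shapeThree_iff : ∀ k l : Fin 13, ∀ a q : Fin 3,
    sees (shapeThree k l a) q ↔ ∃ p, cell l a p ∧ cell k p q := by
  decide +kernel

theorem sum_cell_eq_shapeThree : ∀ k l : Fin 13, ∀ a : Fin 3,
    (∑ p : Fin 3, ∑ q : Fin 3, (cell l a p && cell k p q).toNat * 2 ^ (3 * p.val + q.val)) =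
      shapeThree k l a := by
  decide +kernel

/-! ### Extending compatible decisions to edges and triangles. -/

/-- Whether the decisions on the values of `x` and `y` at the vertices of colours `a` and `b` and
shapes `m` and `n` are compatible. -/
def compat (x y a m b n : ℕ) : Bool :=
  !(decide (x < y) && shapeRel x y a m b n) && !(decide (y < x) && shapeRel y x b n a m)

theorem exists_compat_edge : ∀ k l : Fin 13, ∀ a b x : Fin 3, a ≠ b →
    sees (shapeThree k l a) x → ∃ y : Fin 3, sees (shapeThree k l b) y ∧
      compat x y a (shapeThree k l a) b (shapeThree k l b) := by
  decide +kernel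

/-- For `x ≠ y` this is the triangle rule: if neither `z = x` nor `z = y` were possible, the pair
would already be excluded on the given edge. For `x = y` any `z` keeps the number of values at two,
and compatibility is what the finite check supplies. -/
theorem exists_compat_triangle : ∀ k l : Fin 13, ∀ c x y : Fin 3,
    sees (shapeThree k l (c + 1)) x → sees (shapeThree k l (c + 2)) y →
    compat x y (c + 1 : Fin 3) (shapeThree k l (c + 1)) (c + 2 : Fin 3) (shapeThree k l (c + 2)) →
    ∃ z : Fin 3, sees (shapeThree k l c) z ∧ (z = x ∨ z = y ∨ x = y) ∧
      compat x z (c + 1 : Fin 3) (shapeThree k l (c + 1)) c (shapeThree k l c) ∧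
      compat y z (c + 2 : Fin 3) (shapeThree k l (c + 2)) c (shapeThree k l c) := by
  decide +kernel

/-! ### Simulations, morphisms and positive formulas -/

theorem FormulaD.sat_or {Ag Vin α : Type} [Fintype Ag] {M : SimplicialModel Ag Vin α}
    {φ ψ : FormulaD Ag Vin} {X : Finset α} : (φ.or ψ).Sat M X ↔ φ.Sat M X ∨ ψ.Sat M X := by
  simp only [FormulaD.or, FormulaD.Sat]
  tauto

/-- Truth passes from the simulating model back to the simulated one. Negation is harmless because
it meets only atoms, on which related facets agree. For `D_A`, the forth condition matches each `Y`
that shares the colours `A` with `X` by a `Y'` that shares them with `X'`. -/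
theorem FormulaD.IsPositive.sat_of_isDSimulation {Ag Vin α β : Type} [Fintype Ag]
    {M : SimplicialModel Ag Vin α} {M' : SimplicialModel Ag Vin β}
    {R : Finset α → Finset β → Prop} (hR : IsDSimulation M M' R) {φ : FormulaD Ag Vin}
    (hφ : φ.IsPositive) {X : Finset α} {X' : Finset β} (h : R X X') (hX' : φ.Sat M' X') :
    φ.Sat M X := by
  induction hφ generalizing X X' with
  | atom p => simpa only [FormulaD.Sat, hR.atom X X' h] using hX'
  | negAtom p => simpa only [FormulaD.Sat, hR.atom X X' h] using hX'
  | or _ _ ih₁ ih₂ =>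
    rw [FormulaD.sat_or] at hX' ⊢
    exact hX'.imp (ih₁ h) (ih₂ h)
  | and _ _ ih₁ ih₂ => exact ⟨ih₁ h hX'.1, ih₂ h hX'.2⟩
  | D A _ ih =>
    intro Y hY hA
    obtain ⟨hX, hXM⟩ := hR.facet X X' h
    obtain ⟨Y', hY', hYY', hsub⟩ := hR.forth X hX Y hY X' hXM h
    exact ih hYY' (hX' Y' hY' (hA.trans hsub))

theorem IsTotalDSimulation.valid {Ag Vin α β : Type} [Fintype Ag]
    {M : SimplicialModel Ag Vin α} {M' : SimplicialModel Ag Vin β}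
    {R : Finset α → Finset β → Prop} (hR : IsTotalDSimulation M M' R) {φ : FormulaD Ag Vin}
    (hφ : φ.IsPositive) (h : φ.Valid M') : φ.Valid M := fun X hX =>
  let ⟨X', hX', hXX'⟩ := hR.total X hX
  hφ.sat_of_isDSimulation hR.toIsDSimulation hXX' (h X' hX')

theorem not_isLogicalObstruction_of_isTotalDSimulation {Ag Vin α β γ : Type} [Fintype Ag]
    [DecidableEq Ag] {I : SimplicialModel Ag Vin α} {T : ActionModel Ag Vin β}
    {P : ActionModel Ag Vin γ} {R : Finset (α × γ) → Finset (α × β) → Prop}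
    (hR : IsTotalDSimulation (productUpdate I P) (productUpdate I T) R) (φ : FormulaD Ag Vin) :
    ¬ IsLogicalObstruction I T P φ := fun h => h.2.2 (hR.valid h.1 h.2.1)

section Morphism

variable {Ag Vin α β γ : Type} [Fintype Ag] {M : SimplicialModel Ag Vin α}
  {M' : SimplicialModel Ag Vin β} {f : α → β}

/-- The colouring bounds the size of simplices by the number of agents, so enlarging a simplex
terminates even in an infinite complex. -/
theorem exists_superset_facet {M : SimplicialModel Ag Vin α} {X : Finset α} (hX : X ∈ M.faces) :
    ∃ Y ∈ M.facets, X ⊆ Y := by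
  classical
  have hbound : ∀ Z ∈ M.faces, Z.card ≤ Fintype.card Ag := fun Z hZ => by
    rw [← Finset.card_image_of_injOn (M.chromatic Z hZ)]
    exact Finset.card_le_univ _
  induction hn : Fintype.card Ag - X.card using Nat.strong_induction_on generalizing X with
  | _ n ih =>
    by_cases hmax : Maximal (· ∈ M.faces) X
    · exact ⟨X, hmax, subset_rfl⟩
    · obtain ⟨Z, hXZ, hZ⟩ := exists_gt_of_not_maximal hX hmax
      have hlt := Finset.card_lt_card hXZ
      have := hbound Z hZ
      obtain ⟨Y, hY, hZY⟩ := ih _ (by omega) hZ rfl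
      exact ⟨Y, hY, hXZ.1.trans hZY⟩

/-- Preservation of colours makes `f` injective on `X`, so the image has one vertex per agent; by
purity it cannot be enlarged. -/
theorem IsMorphism.exists_image_facet (hf : IsMorphism M M' f) {X : Finset α}
    (hX : X ∈ M.facets) : ∃ Y ∈ M'.facets, (Y : Set β) = f '' (X : Set α) := by
  classical
  obtain ⟨Y, hY, hYX⟩ := hf.map_simplex X hX.prop
  obtain ⟨Z, hZ, hYZ⟩ := exists_superset_facet hY
  refine ⟨Y, ?_, hYX⟩
  have hinj : Set.InjOn f (X : Set α) := fun v hv w hw e => by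
    refine M.chromatic X hX.prop hv hw ?_
    rw [← hf.map_color v ⟨X, hX.prop, hv⟩, ← hf.map_color w ⟨X, hX.prop, hw⟩, e]
  have hcard : Y.card = X.card := by
    rw [← Finset.card_image_of_injOn hinj]
    congr 1
    exact_mod_cast hYX
  rwa [Finset.eq_of_subset_of_card_le hYZ (by rw [hcard, M.pure X hX, M'.pure Z hZ])]

theorem IsMorphism.common_subset (hf : IsMorphism M M' f) {X Y : Finset α} {X' Y' : Finset β}
    (hX : X ∈ M.facets) (hX' : (X' : Set β) = f '' (X : Set α))
    (hY' : (Y' : Set β) = f '' (Y : Set α)) : M.common X Y ⊆ M'.common X' Y' := by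
  rintro _ ⟨v, ⟨hvX, hvY⟩, rfl⟩
  exact ⟨f v, ⟨hX' ▸ ⟨v, hvX, rfl⟩, hY' ▸ ⟨v, hvY, rfl⟩⟩, hf.map_color v ⟨X, hX.prop, hvX⟩⟩

theorem IsMorphism.labels_eq (hf : IsMorphism M M' f) {X : Finset α} {X' : Finset β}
    (hX : X ∈ M.facets) (hX' : (X' : Set β) = f '' (X : Set α)) :
    M.labels X = M'.labels X' := by
  have hmem : ∀ w, w ∈ X' ↔ ∃ v ∈ X, f v = w := fun w => by
    rw [← Finset.mem_coe, hX']
    rfl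
  ext p
  simp only [SimplicialModel.labels, Set.mem_iUnion, exists_prop, hmem]
  constructor
  · rintro ⟨v, hv, hp⟩
    exact ⟨f v, ⟨v, hv, rfl⟩, by rwa [hf.map_label v ⟨X, hX.prop, hv⟩]⟩
  · rintro ⟨_, ⟨v, hv, rfl⟩, hp⟩
    exact ⟨v, hv, by rwa [hf.map_label v ⟨X, hX.prop, hv⟩] at hp⟩

theorem IsTotalDSimulation.comp_isMorphism {N : SimplicialModel Ag Vin γ}
    {R : Finset β → Finset γ → Prop} (hR : IsTotalDSimulation M' N R) (hf : IsMorphism M M' f) :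
    IsTotalDSimulation M N fun X Z =>
      X ∈ M.facets ∧ ∃ Y ∈ M'.facets, (Y : Set β) = f '' (X : Set α) ∧ R Y Z where
  facet := fun X Z ⟨hX, Y, _, _, h⟩ => ⟨hX, (hR.facet Y Z h).2⟩
  atom := fun X Z ⟨hX, Y, _, hYX, h⟩ => (hf.labels_eq hX hYX).trans (hR.atom Y Z h)
  forth := by
    rintro X hX W hW Z hZ ⟨-, Y, hY, hYX, h⟩
    obtain ⟨V, hV, hVW⟩ := hf.exists_image_facet hW
    obtain ⟨U, hU, hVU, hsub⟩ := hR.forth Y hY V hV Z hZ h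
    exact ⟨U, hU, ⟨hW, V, hV, hVW, hVU⟩, (hf.common_subset hX hYX hVW).trans hsub⟩
  total := by
    intro X hX
    obtain ⟨Y, hY, hYX⟩ := hf.exists_image_facet hX
    obtain ⟨Z, hZ, h⟩ := hR.total Y hY
    exact ⟨Z, hZ, hX, Y, hY, hYX, h⟩

end Morphism

/-! ### The facets of the models -/

section Facets

variable {Ag Vin : Type}

theorem mem_graph [Fintype Ag] {β : Type} {f : Ag → β} {x : Ag × β} :
    x ∈ graph f ↔ f x.1 = x.2 := by
  constructor
  · intro h
    obtain ⟨a, -, rfl⟩ := Finset.mem_map.mp h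
    rfl
  · rintro h
    exact Finset.mem_map.mpr ⟨x.1, Finset.mem_univ _, Prod.ext rfl h⟩

theorem exists_eq_graph [Fintype Ag] {β : Type} {X : Finset (Ag × β)}
    (hX : IsColorful Prod.fst X) : ∃ f : Ag → β, X = graph f := by
  choose v hv hv' using fun a => (hX a).exists
  refine ⟨fun a => (v a).2, ?_⟩
  ext ⟨a, y⟩
  rw [mem_graph]
  constructor
  · intro h
    rw [← (hX a).unique ⟨h, rfl⟩ ⟨hv a, hv' a⟩]
  · rintro h
    have := hv a
    rwa [show v a = (a, y) from Prod.ext (hv' a) h] at this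

theorem graph_mem_facets_inputModel [Fintype Ag] [Nonempty Ag] (i : Ag → Vin) :
    graph i ∈ (inputModel Ag Vin).facets := by
  have hc := isColorful_graph i
  refine ⟨⟨?_, hc.injOn⟩, fun Y hY hle x hx => ?_⟩
  · rw [← Finset.card_pos, hc.card]
    exact Fintype.card_pos
  · obtain ⟨y, ⟨hy, e⟩, -⟩ := hc x.1
    rwa [← hY.2 (hle hy) hx e]

theorem mem_facets_inputModel [Fintype Ag] [Nonempty Ag] {X : Finset (Ag × Vin)} :
    X ∈ (inputModel Ag Vin).facets ↔ ∃ i, X = graph i := by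
  refine ⟨fun h => exists_eq_graph ((inputModel Ag Vin).pure.colorful h), ?_⟩
  rintro ⟨i, rfl⟩
  exact graph_mem_facets_inputModel i

theorem mem_labels_graph [Fintype Ag] {i : Ag → Vin} {p : Atom Ag Vin} :
    p ∈ (inputModel Ag Vin).labels (graph i) ↔ i p.agent = p.value := by
  simp only [SimplicialModel.labels, Set.mem_iUnion, exists_prop, inputModel,
    Set.mem_singleton_iff]
  constructor
  · rintro ⟨v, hv, rfl⟩
    exact mem_graph.mp hv
  · intro h
    exact ⟨(p.agent, p.value), mem_graph.mpr h, rfl⟩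

variable {α ι : Type} [Fintype Ag] [Inhabited Ag] [Inhabited Vin] {M : SimplicialModel Ag Vin α}
  {X : Finset α} {s : Finset ι} {φ : ι → FormulaK Ag Vin}

theorem FormulaK.not_sat_bot : ¬ (FormulaK.bot : FormulaK Ag Vin).Sat M X :=
  fun h => h.2 h.1

theorem FormulaK.sat_bigAnd : (FormulaK.bigAnd s φ).Sat M X ↔ ∀ x ∈ s, (φ x).Sat M X := by
  have h : ∀ L : List ι, (L.foldr (fun x ψ => FormulaK.and (φ x) ψ) (.neg .bot)).Sat M X ↔
      ∀ x ∈ L, (φ x).Sat M X := by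
    intro L
    induction L with
    | nil => simpa [FormulaK.Sat] using FormulaK.not_sat_bot
    | cons a L ih => simp [FormulaK.Sat, ih]
  simp [FormulaK.bigAnd, h]

theorem FormulaK.sat_bigOr : (FormulaK.bigOr s φ).Sat M X ↔ ∃ x ∈ s, (φ x).Sat M X := by
  have h : ∀ L : List ι, (L.foldr (fun x ψ => FormulaK.or (φ x) ψ) .bot).Sat M X ↔
      ∃ x ∈ L, (φ x).Sat M X := by
    intro L
    induction L with
    | nil => simpa using FormulaK.not_sat_bot
    | cons a L ih =>
      simp only [List.foldr_cons, FormulaK.or, FormulaK.Sat, List.mem_cons, exists_eq_or_imp]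
      rw [← ih]
      tauto
  simp [FormulaK.bigOr, h]

end Facets

section Facets

variable {Ag Vin : Type} [Fintype Ag]

theorem mem_snapFacet {r : ℕ} {i : Ag → Vin} {v : Ag → Views Ag Vin r}
    {x : SnapVertex Ag Vin r} :
    x ∈ snapFacet i v ↔ x = snapVertex x.1.1 (i x.1.1) (v x.1.1) := by
  constructor
  · intro h
    obtain ⟨a, -, rfl⟩ := Finset.mem_map.mp h
    rfl
  · intro h
    exact Finset.mem_map.mpr ⟨x.1.1, Finset.mem_univ _, h.symm⟩

theorem mem_agreeFacet {i d : Ag → Vin} {x : AgreeVertex Ag Vin} :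
    x ∈ agreeFacet i d ↔ x = ((x.1.1, i x.1.1), (x.1.1, d x.1.1)) := by
  constructor
  · intro h
    obtain ⟨a, -, rfl⟩ := Finset.mem_map.mp h
    rfl
  · intro h
    exact Finset.mem_map.mpr ⟨x.1.1, Finset.mem_univ _, h.symm⟩

theorem mem_facets_setAgreement [Inhabited Ag] [Inhabited Vin] [DecidableEq Vin] {k : ℕ} {T : Finset (Ag × Vin)} :
    T ∈ (setAgreement Ag Vin k).facets ↔
      ∃ d : Ag → Vin, (Finset.univ.image d).card ≤ k ∧ T = graph d := by
  refine mem_facets_ofFacets (hF := ?_)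
  rintro _ ⟨e, -, rfl⟩
  exact isColorful_graph _

variable [DecidableEq Ag]

theorem colorProd_graph_snap {r : ℕ} (i : Ag → Vin) (v : Ag → Views Ag Vin r) :
    colorProd Prod.fst Prod.fst (graph i) (graph fun a => (i a, v a)) = snapFacet i v := by
  ext ⟨⟨a, x⟩, ⟨b, y, w⟩⟩
  simp only [colorProd, Finset.mem_filter, Finset.mem_product, mem_graph, mem_snapFacet,
    snapVertex, Prod.mk.injEq]
  constructor
  · rintro ⟨⟨rfl, rfl, rfl⟩, rfl⟩
    simp
  · rintro ⟨⟨-, rfl⟩, rfl, rfl, rfl⟩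
    simp

theorem colorProd_graph_agree (i d : Ag → Vin) :
    colorProd Prod.fst Prod.fst (graph i) (graph d) = agreeFacet i d := by
  ext ⟨⟨a, x⟩, ⟨b, y⟩⟩
  simp only [colorProd, Finset.mem_filter, Finset.mem_product, mem_graph, mem_agreeFacet,
    Prod.mk.injEq]
  constructor
  · rintro ⟨⟨rfl, rfl⟩, rfl⟩
    simp
  · rintro ⟨⟨-, rfl⟩, rfl, rfl⟩
    simp

theorem mem_facets_productUpdate {α β : Type} [Nonempty Ag] {M : SimplicialModel Ag Vin α}
    {A : ActionModel Ag Vin β} {Z : Finset (α × β)} :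
    Z ∈ (productUpdate M A).facets ↔
      ∃ X ∈ M.facets, ∃ T ∈ A.facets, (A.pre T).Sat M X ∧ Z = colorProd M.χ A.χ X T := by
  refine mem_facets_ofFacets (hF := ?_)
  rintro Z ⟨X, hX, T, hT, -, rfl⟩
  exact isColorful_colorProd (M.pure.colorful hX) (A.pure.colorful hT)

variable [Inhabited Ag] [Inhabited Vin]

theorem mem_facets_snapshot {r : ℕ} {T : Finset (Ag × Vin × Views Ag Vin r)} :
    T ∈ (snapshot Ag Vin r).facets ↔ ∃ (i : Ag → Vin) (γ : Fin r → OrderedPartition Ag),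
      T = graph fun a => (i a, view i r γ a) := by
  refine (mem_facets_ofFacets (hF := ?_)).trans ⟨?_, ?_⟩
  · rintro _ ⟨j, -, δ, rfl⟩
    exact isColorful_graph _
  · rintro ⟨i, -, γ, h⟩
    exact ⟨i, γ, h⟩
  · rintro ⟨i, γ, h⟩
    exact ⟨i, graph_mem_facets_inputModel i, γ, h⟩

theorem mem_facets_snapshotModel {r : ℕ} {X : Finset (SnapVertex Ag Vin r)} :
    X ∈ (productUpdate (inputModel Ag Vin) (snapshot Ag Vin r)).facets ↔
      ∃ (i : Ag → Vin) (γ : Fin r → OrderedPartition Ag), X = runFacet i γ := by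
  refine mem_facets_productUpdate.trans ⟨?_, ?_⟩
  · rintro ⟨Y, hY, T, hT, hpre, rfl⟩
    obtain ⟨i, rfl⟩ := mem_facets_inputModel.mp hY
    obtain ⟨j, γ, rfl⟩ := mem_facets_snapshot.mp hT
    -- The precondition forces the inputs recorded in the action to be the actual ones.
    obtain rfl : i = j := by
      funext a
      have := FormulaK.sat_bigAnd.mp hpre (a, j a, view j r γ a) (mem_graph.mpr rfl)
      exact mem_labels_graph.mp this
    exact ⟨i, γ, colorProd_graph_snap i _⟩
  · rintro ⟨i, γ, rfl⟩
    refine ⟨graph i, graph_mem_facets_inputModel i, graph fun a => (i a, view i r γ a),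
      mem_facets_snapshot.mpr ⟨i, γ, rfl⟩, ?_,
      (colorProd_graph_snap i _).symm⟩
    refine FormulaK.sat_bigAnd.mpr fun x hx => mem_labels_graph.mpr ?_
    exact congrArg Prod.fst (mem_graph.mp hx)

theorem mem_facets_agreeModel [DecidableEq Vin] {k : ℕ} {X : Finset (AgreeVertex Ag Vin)} :
    X ∈ (productUpdate (inputModel Ag Vin) (setAgreement Ag Vin k)).facets ↔
      ∃ i d : Ag → Vin, (Finset.univ.image d).card ≤ k ∧ (∀ a, ∃ b, i b = d a) ∧
        X = agreeFacet i d := by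
  refine mem_facets_productUpdate.trans ⟨?_, ?_⟩
  · rintro ⟨Y, hY, T, hT, hpre, rfl⟩
    obtain ⟨i, rfl⟩ := mem_facets_inputModel.mp hY
    obtain ⟨d, hd, rfl⟩ := mem_facets_setAgreement.mp hT
    refine ⟨i, d, hd, fun a => ?_, colorProd_graph_agree i d⟩
    have := FormulaK.sat_bigAnd.mp hpre (a, d a) (mem_graph.mpr rfl)
    obtain ⟨b, -, hb⟩ := FormulaK.sat_bigOr.mp this
    exact ⟨b, mem_labels_graph.mp hb⟩
  · rintro ⟨i, d, hd, hid, rfl⟩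
    refine ⟨graph i, graph_mem_facets_inputModel i, graph d,
      mem_facets_setAgreement.mpr ⟨d, hd, rfl⟩, ?_, (colorProd_graph_agree i d).symm⟩
    refine FormulaK.sat_bigAnd.mpr fun x hx => FormulaK.sat_bigOr.mpr ?_
    obtain ⟨b, hb⟩ := hid x.1
    exact ⟨b, Finset.mem_univ b, mem_labels_graph.mpr (hb.trans (mem_graph.mp hx))⟩

end Facets

/-! ### The vertices of two rounds of immediate snapshot -/

/-- The view of `a` after the rounds `partitionThree k`, `partitionThree l` on the input `i`. -/
def viewThree (i : Fin 3 → Fin 3) (k l : Fin 13) (a : Fin 3) : Views (Fin 3) (Fin 3) 2 :=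
  fun p => if cell l a p then some fun q => if cell k p q then some (i q) else none else none

theorem view_partitionThree (i : Fin 3 → Fin 3) (k l : Fin 13) :
    view i 2 ![partitionThree k, partitionThree l] = viewThree i k l := by
  funext a p
  change (if p ∈ (partitionThree l).block a then
    some fun q => if q ∈ (partitionThree k).block p then some (i q) else none else none) = _
  simp only [viewThree, mem_block_partitionThree]
  rfl

/-- The vertex of colour `a` in the facet of the run with input `i` and rounds `partitionThree k`,
`partitionThree l`. -/
def vertexThree (i : Fin 3 → Fin 3) (k l : Fin 13) (a : Fin 3) : SnapVertex (Fin 3) (Fin 3) 2 :=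
  snapVertex a (i a) (viewThree i k l a)

/-- The facet of the run with input `i` and rounds `partitionThree k`, `partitionThree l`. -/
def facetThree (i : Fin 3 → Fin 3) (k l : Fin 13) : Finset (SnapVertex (Fin 3) (Fin 3) 2) :=
  snapFacet i (viewThree i k l)

theorem mem_facetThree {i : Fin 3 → Fin 3} {k l : Fin 13} {x : SnapVertex (Fin 3) (Fin 3) 2} :
    x ∈ facetThree i k l ↔ ∃ a, vertexThree i k l a = x := by
  rw [facetThree, mem_snapFacet]
  constructor
  · intro h
    exact ⟨x.1.1, h.symm⟩
  · rintro ⟨a, rfl⟩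
    rfl

theorem mem_facets_inputIS_two {X : Finset (SnapVertex (Fin 3) (Fin 3) 2)} :
    X ∈ (inputIS 2).facets ↔ ∃ i k l, X = facetThree i k l := by
  rw [mem_facets_snapshotModel]
  constructor
  · rintro ⟨i, γ, rfl⟩
    obtain ⟨k, hk⟩ := exists_partitionThree (γ 0)
    obtain ⟨l, hl⟩ := exists_partitionThree (γ 1)
    refine ⟨i, k, l, ?_⟩
    have hγ : γ = ![γ 0, γ 1] := by
      funext j
      fin_cases j <;> rfl
    rw [facetThree, ← view_partitionThree, ← hk, ← hl, ← hγ]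
    rfl
  · rintro ⟨i, k, l, rfl⟩
    exact ⟨i, ![partitionThree k, partitionThree l], by rw [runFacet, view_partitionThree]; rfl⟩

theorem vertexThree_injective (i : Fin 3 → Fin 3) (k l : Fin 13) :
    Function.Injective (vertexThree i k l) := fun _ _ h => congrArg (fun x => x.1.1) h

/-- The shape of a view of level two. -/
def viewShape (v : Views (Fin 3) (Fin 3) 2) : ℕ :=
  ∑ p : Fin 3, ∑ q : Fin 3,
    (Option.bind (v p) fun w : Fin 3 → Option (Fin 3) => w q).isSome.toNat *
      2 ^ (3 * p.val + q.val)

/-- `viewShape` reads the shape off from the view alone, so a vertex has the same shape in every run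
that contains it. -/
theorem viewShape_viewThree (i : Fin 3 → Fin 3) (k l : Fin 13) (a : Fin 3) :
    viewShape (viewThree i k l a) = shapeThree k l a := by
  rw [← sum_cell_eq_shapeThree]
  refine Finset.sum_congr rfl fun p _ => Finset.sum_congr rfl fun q _ => ?_
  congr 2
  change (Option.bind (if cell l a p then some fun q => if cell k p q then some (i q) else none
    else none) fun w : Fin 3 → Option (Fin 3) => w q).isSome = _
  cases cell l a p
  · rfl
  · change (if cell k p q then some (i q) else none).isSome = _
    cases cell k p q <;> rfl

theorem mem_car_viewThree {i : Fin 3 → Fin 3} {k l : Fin 13} {a : Fin 3} {x : Fin 3 × Fin 3} :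
    x ∈ car 1 (viewThree i k l a) ↔ sees (shapeThree k l a) x.1 ∧ i x.1 = x.2 := by
  rw [sees_shapeThree_iff]
  constructor
  · rintro ⟨p, w, hw, hx⟩
    have hx' : w x.1 = some x.2 := hx
    unfold viewThree at hw
    split_ifs at hw with h
    cases hw
    change (if cell k p x.1 then some (i x.1) else none) = some x.2 at hx'
    split_ifs at hx' with h'
    exact ⟨⟨p, h, h'⟩, Option.some.inj hx'⟩
  · rintro ⟨⟨p, h, h'⟩, hx⟩
    refine ⟨p, fun q => if cell k p q then some (i q) else none, by rw [viewThree, if_pos h], ?_⟩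
    show (if cell k p x.1 then some (i x.1) else none) = some x.2
    rw [if_pos h', hx]

theorem inView_vertexThree {q : Fin 3} {i : Fin 3 → Fin 3} {k l : Fin 13} {a : Fin 3} :
    InView q (vertexThree i k l a) ↔ sees (shapeThree k l a) q := by
  constructor
  · rintro ⟨y, hy⟩
    exact (mem_car_viewThree.mp hy).1
  · intro h
    exact ⟨i q, mem_car_viewThree.mpr ⟨h, rfl⟩⟩

section CommonVertex

variable {i i' : Fin 3 → Fin 3} {k l k' l' : Fin 13} {a b : Fin 3}

theorem color_eq_of_vertexThree_eq (h : vertexThree i k l a = vertexThree i' k' l' b) : a = b :=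
  congrArg (fun x => x.1.1) h

theorem viewThree_eq_of_vertexThree_eq (h : vertexThree i k l a = vertexThree i' k' l' b) :
    viewThree i k l a = viewThree i' k' l' b := congrArg (fun x => x.2.2.2) h

theorem shapeThree_eq_of_vertexThree_eq (h : vertexThree i k l a = vertexThree i' k' l' b) :
    shapeThree k l a = shapeThree k' l' b := by
  rw [← viewShape_viewThree i, ← viewShape_viewThree i', viewThree_eq_of_vertexThree_eq h]

theorem input_eq_of_vertexThree_eq (h : vertexThree i k l a = vertexThree i' k' l' b) {q : Fin 3}
    (hq : sees (shapeThree k l a) q) : i q = i' q := by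
  have hcar : (q, i q) ∈ car 1 (viewThree i k l a) := mem_car_viewThree.mpr ⟨hq, rfl⟩
  rw [viewThree_eq_of_vertexThree_eq h] at hcar
  exact (mem_car_viewThree.mp hcar).2.symm

theorem vertexThree_congr (h : ∀ x, cell l' a x = cell l a x) :
    vertexThree i k l' a = vertexThree i k l a := by
  refine congrArg (snapVertex a (i a)) (funext fun p => ?_)
  simp only [viewThree, h]

end CommonVertex

/-! ### The relations `R^{p,q}` in terms of shapes -/

theorem exists_vertexThree_of_mem_faces {t : Finset (SnapVertex (Fin 3) (Fin 3) 2)}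
    (ht : t ∈ (inputIS 2).faces) : ∃ i k l, ∀ x ∈ t, ∃ a, vertexThree i k l a = x := by
  obtain ⟨Y, hY, htY⟩ := exists_superset_facet ht
  obtain ⟨i, k, l, rfl⟩ := mem_facets_inputIS_two.mp hY
  exact ⟨i, k, l, fun x hx => mem_facetThree.mp (htY hx)⟩

theorem image_vertexThree_mem_faces (i : Fin 3 → Fin 3) (k l : Fin 13) {s : Finset (Fin 3)}
    (hs : s.Nonempty) : s.map ⟨_, vertexThree_injective i k l⟩ ∈ (inputIS 2).faces := by
  have h : facetThree i k l ∈ (inputIS 2).facets := mem_facets_inputIS_two.mpr ⟨i, k, l, rfl⟩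
  refine ((inputIS 2).isRelLowerSet_faces h.prop).2 ?_ (hs.map)
  intro x hx
  obtain ⟨a, -, rfl⟩ := Finset.mem_map.mp hx
  exact mem_facetThree.mpr ⟨a, rfl⟩

theorem eq_neg_add : ∀ a b c : Fin 3, a ≠ b → c ≠ a → c ≠ b → c = -(a + b) := by decide

theorem neg_add_ne : ∀ a b : Fin 3, a ≠ b → -(a + b) ≠ a ∧ -(a + b) ≠ b := by decide

theorem relN_zero_vertexThree {p q : Fin 3} {i : Fin 3 → Fin 3} {k l : Fin 13} {a b : Fin 3}
    (hab : a ≠ b) : relN p q 0 (vertexThree i k l a) (vertexThree i k l b) ↔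
      (!sees (shapeThree k l a) p || !sees (shapeThree k l b) q) := by
  simp only [relN, inView_vertexThree, Bool.or_eq_true, Bool.not_eq_true', Bool.not_eq_true]
  refine and_iff_right ⟨_, image_vertexThree_mem_faces i k l (s := {a, b}) (by simp), ?_, ?_⟩
  · rw [Finset.card_map, Finset.card_pair hab]
  · simp [Set.image_pair]

/-- The cardinality demanded of the edge or triangle is what keeps the two ends apart. -/
theorem exists_vertexThree_of_relN {p q : Fin 3} {n : ℕ} {x y : SnapVertex (Fin 3) (Fin 3) 2}
    (h : relN p q n x y) : ∃ i k l a b, a ≠ b ∧ vertexThree i k l a = x ∧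
      vertexThree i k l b = y := by
  induction n with
  | zero =>
    obtain ⟨⟨e, he, hcard, hxy⟩, -⟩ := h
    obtain ⟨i, k, l, hv⟩ := exists_vertexThree_of_mem_faces he
    have hxe : x ∈ e := by rw [← Finset.mem_coe, hxy]; simp
    have hye : y ∈ e := by rw [← Finset.mem_coe, hxy]; simp
    obtain ⟨a, rfl⟩ := hv x hxe
    obtain ⟨b, rfl⟩ := hv y hye
    refine ⟨i, k, l, a, b, ?_, rfl, rfl⟩
    rintro rfl
    rw [Set.pair_eq_singleton, Finset.coe_eq_singleton] at hxy
    simp [hxy] at hcard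
  | succ n ih =>
    obtain h | ⟨z, -, -, t, ht, hcard, hxyz⟩ := h
    · exact ih h
    · obtain ⟨i, k, l, hv⟩ := exists_vertexThree_of_mem_faces ht
      have hxt : x ∈ t := by rw [← Finset.mem_coe, hxyz]; simp
      have hyt : y ∈ t := by rw [← Finset.mem_coe, hxyz]; simp
      obtain ⟨a, rfl⟩ := hv x hxt
      obtain ⟨b, rfl⟩ := hv y hyt
      refine ⟨i, k, l, a, b, ?_, rfl, rfl⟩
      rintro rfl
      classical
      have : t = {vertexThree i k l a, z} := by
        rw [← Finset.coe_inj, hxyz]; simp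
      have := this ▸ Finset.card_le_two (a := vertexThree i k l a) (b := z)
      omega

theorem shapeStage_of_relN {p q : Fin 3} (hpq : p < q) {n : ℕ} : ∀ {i : Fin 3 → Fin 3}
    {k l : Fin 13} {a b : Fin 3}, a ≠ b → relN p q n (vertexThree i k l a) (vertexThree i k l b) →
    shapeStage 5 p q a (shapeThree k l a) b (shapeThree k l b) := by
  induction n with
  | zero =>
    intro i k l a b hab h
    simp [shapeStage, (relN_zero_vertexThree hab).mp h]
  | succ n ih =>
    intro i k l a b hab h
    obtain h | ⟨z, hxz, hzy, t, ht, hcard, hxyz⟩ := h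
    · exact ih hab h
    -- The triangle may lie in another run than the given one, but the shapes at the two ends are
    -- the same there.
    · obtain ⟨i', k', l', hv⟩ := exists_vertexThree_of_mem_faces ht
      have hmem : ∀ w, w ∈ t ↔ w = vertexThree i k l a ∨ w = vertexThree i k l b ∨ w = z := by
        intro w; rw [← Finset.mem_coe, hxyz]; simp
      obtain ⟨a', ha⟩ := hv _ ((hmem _).mpr (.inl rfl))
      obtain ⟨b', hb⟩ := hv _ ((hmem _).mpr (.inr (.inl rfl)))
      obtain ⟨c, rfl⟩ := hv z ((hmem _).mpr (.inr (.inr rfl)))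
      obtain rfl := color_eq_of_vertexThree_eq ha
      obtain rfl := color_eq_of_vertexThree_eq hb
      rw [← ha] at hxz
      rw [← hb] at hzy
      rw [← shapeThree_eq_of_vertexThree_eq ha, ← shapeThree_eq_of_vertexThree_eq hb]
      have hne : ∀ {u v}, relN p q n (vertexThree i' k' l' u) (vertexThree i' k' l' v) → u ≠ v := by
        rintro u v h rfl
        obtain ⟨i, k, l, a, b, hne, h1, h2⟩ := exists_vertexThree_of_relN h
        exact hne (vertexThree_injective i k l (h1.trans h2.symm))
      have hca := (hne hxz).symm
      have hcb := hne hzy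
      obtain rfl := eq_neg_add a' b' c hab hca hcb
      exact shapeStage_trans k' l' p q a' b' hpq hab (ih hca.symm hxz) (ih hcb hzy)

theorem relN_mono {p q : Fin 3} {m n : ℕ} (h : m ≤ n) {x y : SnapVertex (Fin 3) (Fin 3) 2}
    (hxy : relN p q m x y) : relN p q n x y := by
  induction h with
  | refl => exact hxy
  | step _ ih => exact .inl ih

theorem relN_of_shapeStage {p q : Fin 3} (hpq : p < q) {s : ℕ} (hs : s ≤ 5) :
    ∀ {i : Fin 3 → Fin 3} {k l : Fin 13} {a b : Fin 3}, a ≠ b →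
    shapeStage s p q a (shapeThree k l a) b (shapeThree k l b) →
    relN p q s (vertexThree i k l a) (vertexThree i k l b) := by
  induction s with
  | zero =>
    intro i k l a b hab h
    rw [relN_zero_vertexThree hab]
    simpa [shapeStage, derivedEdge] using h
  | succ s ih =>
    intro i k l a b hab h
    by_cases hsee : sees (shapeThree k l a) p ∧ sees (shapeThree k l b) q
    · have hrel := shapeRel_of_shapeStage hsee.1 hsee.2 h
      obtain h | ⟨l', ha, hb, hac, hcb⟩ :=
        exists_triangle_of_shapeRel k l p q a b hpq hab hrel ⟨s, by omega⟩ h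
      · exact .inl (ih (by omega) hab h)
      · obtain ⟨hca, hcb'⟩ := neg_add_ne a b hab
        rw [← vertexThree_congr ha, ← vertexThree_congr hb]
        refine .inr ⟨vertexThree i k l' (-(a + b)), ih (by omega) hca.symm hac,
          ih (by omega) hcb' hcb, _,
          image_vertexThree_mem_faces i k l' (s := {a, b, -(a + b)}) (by simp), ?_, ?_⟩
        · rw [Finset.card_map, Finset.card_eq_three]
          exact ⟨a, b, -(a + b), hab, hca.symm, hcb'.symm, rfl⟩
        · simp [Set.image_insert_eq]
    -- If one of the two inputs is not visible, the edge already belongs to `R_0^{p,q}`.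
    · refine relN_mono (Nat.zero_le _) ((relN_zero_vertexThree hab).mpr ?_)
      simpa [-not_and, not_and_or] using hsee

theorem rel_vertexThree_iff {p q : Fin 3} (hpq : p < q) {i : Fin 3 → Fin 3} {k l : Fin 13}
    {a b : Fin 3} (hab : a ≠ b) : rel p q (vertexThree i k l a) (vertexThree i k l b) ↔
      shapeRel p q a (shapeThree k l a) b (shapeThree k l b) := by
  rw [rel, relN_zero_vertexThree hab]
  have h : (∃ n, relN p q n (vertexThree i k l a) (vertexThree i k l b)) ↔
      shapeStage 5 p q a (shapeThree k l a) b (shapeThree k l b) :=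
    ⟨fun ⟨_, h⟩ => shapeStage_of_relN hpq hab h, fun h => ⟨5, relN_of_shapeStage hpq le_rfl hab h⟩⟩
  rw [h]
  simp only [shapeRel, Bool.and_eq_true, Bool.or_eq_true, Bool.not_eq_true', not_or,
    Bool.not_eq_false]
  tauto

/-! ### The simulation of `I[IS^2]` by `I[SA_2]` -/

theorem compat_comm (x y a m b n : ℕ) : compat x y a m b n = compat y x b n a m :=
  Bool.and_comm _ _

theorem compat_iff {x y a m b n : ℕ} : compat x y a m b n ↔
    (x < y → ¬ shapeRel x y a m b n) ∧ (y < x → ¬ shapeRel y x b n a m) := by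
  simp [compat, imp_iff_not_or]

theorem card_image_eq_three_iff {i : Fin 3 → Fin 3} :
    (Finset.univ.image i).card = 3 ↔ Function.Injective i := by
  simpa using Finset.card_image_iff (s := Finset.univ) (f := i)

theorem eq_or_eq_add_one_or_eq_add_two : ∀ c x : Fin 3, x = c ∨ x = c + 1 ∨ x = c + 2 := by
  decide

theorem eq_or_eq_or_eq_neg_add : ∀ a b x : Fin 3, a ≠ b → x = a ∨ x = b ∨ x = -(a + b) := by
  decide

/-- The decisions `d` are allowed by the relation `S` in the run with input `i` and rounds
`partitionThree k`, `partitionThree l`. -/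
structure Decides (i : Fin 3 → Fin 3) (k l : Fin 13) (d : Fin 3 → Fin 3) : Prop where
  card_le : (Finset.univ.image d).card ≤ 2
  exists_sees : ∀ a, ∃ q : Fin 3, sees (shapeThree k l a) q ∧ i q = d a
  ne_or_ne : ∀ a b p q : Fin 3, a ≠ b → p < q → Function.Injective i →
    shapeRel p q a (shapeThree k l a) b (shapeThree k l b) → d a ≠ i p ∨ d b ≠ i q

theorem snapFacet_inj {Ag Vin : Type} [Fintype Ag] {r : ℕ} {i j : Ag → Vin}
    {v w : Ag → Views Ag Vin r} (h : snapFacet i v = snapFacet j w) : i = j ∧ v = w := by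
  have key : ∀ a, snapVertex a (i a) (v a) = snapVertex a (j a) (w a) := fun a =>
    mem_snapFacet.mp (h ▸ mem_snapFacet.mpr rfl)
  exact ⟨funext fun a => congrArg (fun x => x.1.2) (key a),
    funext fun a => congrArg (fun x => x.2.2.2) (key a)⟩

theorem agreeFacet_inj {Ag Vin : Type} [Fintype Ag] {i j d e : Ag → Vin}
    (h : agreeFacet i d = agreeFacet j e) : i = j ∧ d = e := by
  have key : ∀ a, (((a, i a), (a, d a)) : AgreeVertex Ag Vin) = ((a, j a), (a, e a)) := fun a =>
    mem_agreeFacet.mp (h ▸ mem_agreeFacet.mpr rfl)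
  exact ⟨funext fun a => congrArg (fun x => x.1.2) (key a),
    funext fun a => congrArg (fun x => x.2.2) (key a)⟩

/-- A facet determines its inputs, views and decisions, so the existential quantifiers in `simS`
leave only the choice of `d`. -/
theorem simS_facetThree_iff {i : Fin 3 → Fin 3} {k l : Fin 13}
    {X' : Finset (AgreeVertex (Fin 3) (Fin 3))} :
    simS (facetThree i k l) X' ↔ ∃ d, Decides i k l d ∧ X' = agreeFacet i d := by
  constructor
  · rintro ⟨-, hX', i₀, v, i', d, hX, rfl, hi, hcar, hrel⟩
    obtain ⟨rfl, rfl⟩ := snapFacet_inj hX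
    obtain rfl : i = i' := funext hi
    obtain ⟨i₁, e, he, -, h⟩ := mem_facets_agreeModel.mp hX'
    obtain ⟨rfl, rfl⟩ := agreeFacet_inj h
    refine ⟨d, ⟨he, fun a => ?_, fun a b p q hab hpq hinj h => ?_⟩, rfl⟩
    · obtain ⟨q, hq⟩ := hcar a
      exact ⟨q, mem_car_viewThree.mp hq⟩
    · exact hrel a b p q hab hpq (card_image_eq_three_iff.mpr hinj)
        ((rel_vertexThree_iff hpq hab).mpr h)
  · rintro ⟨d, hd, rfl⟩
    refine ⟨mem_facets_inputIS_two.mpr ⟨i, k, l, rfl⟩, mem_facets_agreeModel.mpr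
      ⟨i, d, hd.card_le, fun a => (hd.exists_sees a).imp fun _ h => h.2, rfl⟩,
      i, viewThree i k l, i, d, rfl, rfl, fun _ => rfl, fun a => ?_,
      fun a b p q hab hpq hc h => ?_⟩
    · obtain ⟨q, hq⟩ := hd.exists_sees a
      exact ⟨q, mem_car_viewThree.mpr hq⟩
    · exact hd.ne_or_ne a b p q hab hpq (card_image_eq_three_iff.mp hc)
        ((rel_vertexThree_iff hpq hab).mp h)

/-- Compatible decisions at the vertices of colours `c + 1` and `c + 2` extend to a facet. -/
theorem exists_compat_extension {k l : Fin 13} {c x y : Fin 3}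
    (hx : sees (shapeThree k l (c + 1)) x) (hy : sees (shapeThree k l (c + 2)) y)
    (hxy : compat x y (c + 1 : Fin 3) (shapeThree k l (c + 1))
      (c + 2 : Fin 3) (shapeThree k l (c + 2))) :
    ∃ e : Fin 3 → Fin 3, e (c + 1) = x ∧ e (c + 2) = y ∧ (Finset.univ.image e).card ≤ 2 ∧
      (∀ a, sees (shapeThree k l a) (e a)) ∧
      ∀ a b, a ≠ b → compat (e a) (e b) a (shapeThree k l a) b (shapeThree k l b) := by
  obtain ⟨z, hz, hcard, hxz, hyz⟩ := exists_compat_triangle k l c x y hx hy hxy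
  have h10 : c + 1 ≠ c := (by decide : ∀ c : Fin 3, c + 1 ≠ c) c
  have h20 : c + 2 ≠ c := (by decide : ∀ c : Fin 3, c + 2 ≠ c) c
  have h21 : c + 2 ≠ c + 1 := (by decide : ∀ c : Fin 3, c + 2 ≠ c + 1) c
  obtain ⟨e, he0, he1, he2⟩ : ∃ e : Fin 3 → Fin 3, e c = z ∧ e (c + 1) = x ∧ e (c + 2) = y :=
    ⟨fun a => if a = c then z else if a = c + 1 then x else y, by simp, by simp [h10],
      by simp [h20, h21]⟩
  refine ⟨e, he1, he2, ?_, fun a => ?_, fun a b hab => ?_⟩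
  -- It suffices to put the three values into one two-element set.
  · have hsub : ∀ u v : Fin 3, e c ∈ ({u, v} : Finset (Fin 3)) → e (c + 1) ∈ ({u, v} : Finset _) →
        e (c + 2) ∈ ({u, v} : Finset _) → (Finset.univ.image e).card ≤ 2 := by
      intro u v h0 h1 h2
      refine (Finset.card_le_card fun w hw => ?_).trans (Finset.card_le_two (a := u) (b := v))
      obtain ⟨a, -, rfl⟩ := Finset.mem_image.mp hw
      obtain rfl | rfl | rfl := eq_or_eq_add_one_or_eq_add_two c a <;> assumption
    rw [he0, he1, he2] at hsub
    obtain rfl | rfl | rfl := hcard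
    · exact hsub z y (by simp) (by simp) (by simp)
    · exact hsub z x (by simp) (by simp) (by simp)
    · exact hsub z x (by simp) (by simp) (by simp)
  · obtain rfl | rfl | rfl := eq_or_eq_add_one_or_eq_add_two c a
    · rwa [he0]
    · rwa [he1]
    · rwa [he2]
  · rcases eq_or_eq_add_one_or_eq_add_two c a with ha | ha | ha <;>
    rcases eq_or_eq_add_one_or_eq_add_two c b with hb | hb | hb <;>
    rw [ha, hb] at hab ⊢ <;>
    first
      | exact absurd rfl hab
      | (simp only [he0, he1, he2]; first | assumption | (rw [compat_comm]; assumption))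

/-- Admissible decisions on a set of vertices that is not a whole facet extend to the facet. -/
theorem exists_decides_extension {i : Fin 3 → Fin 3} {k l : Fin 13} {d : Fin 3 → Fin 3}
    {A : Set (Fin 3)} {c : Fin 3} (hc : c ∉ A)
    (hsees : ∀ a ∈ A, ∃ q : Fin 3, sees (shapeThree k l a) q ∧ i q = d a)
    (hrel : ∀ a ∈ A, ∀ b ∈ A, ∀ p q : Fin 3, a ≠ b → p < q → Function.Injective i →
      shapeRel p q a (shapeThree k l a) b (shapeThree k l b) → d a ≠ i p ∨ d b ≠ i q) :
    ∃ d', Decides i k l d' ∧ ∀ a ∈ A, d' a = d a := by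
  classical
  by_cases hi : Function.Injective i
  · have h21 : c + 1 ≠ c + 2 := (by decide : ∀ c : Fin 3, c + 1 ≠ c + 2) c
    -- Decisions are handled as the processes `x`, `y` whose inputs are chosen. The two vertices
    -- other than `c` receive them first: those in `A` keep theirs, and a missing one is supplied by
    -- `exists_compat_edge`.
    obtain ⟨x, y, hx, hy, hxy, hxA, hyA⟩ : ∃ x y : Fin 3,
        sees (shapeThree k l (c + 1)) x ∧ sees (shapeThree k l (c + 2)) y ∧
        compat x y (c + 1 : Fin 3) (shapeThree k l (c + 1))
          (c + 2 : Fin 3) (shapeThree k l (c + 2)) ∧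
        (c + 1 ∈ A → i x = d (c + 1)) ∧ (c + 2 ∈ A → i y = d (c + 2)) := by
      by_cases h1 : c + 1 ∈ A
      · obtain ⟨x, hx, hxd⟩ := hsees _ h1
        by_cases h2 : c + 2 ∈ A
        · obtain ⟨y, hy, hyd⟩ := hsees _ h2
          refine ⟨x, y, hx, hy, compat_iff.mpr ⟨fun hlt h => ?_, fun hlt h => ?_⟩,
            fun _ => hxd, fun _ => hyd⟩
          · exact (hrel _ h1 _ h2 x y h21 hlt hi h).elim (· hxd.symm) (· hyd.symm)
          · exact (hrel _ h2 _ h1 y x h21.symm hlt hi h).elim (· hyd.symm) (· hxd.symm)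
        · obtain ⟨y, hy, hxy⟩ := exists_compat_edge k l _ _ x h21 hx
          exact ⟨x, y, hx, hy, hxy, fun _ => hxd, fun h => absurd h h2⟩
      · obtain ⟨y, hy, hyd⟩ : ∃ y : Fin 3, sees (shapeThree k l (c + 2)) y ∧
            (c + 2 ∈ A → i y = d (c + 2)) := by
          by_cases h2 : c + 2 ∈ A
          · obtain ⟨y, hy, hyd⟩ := hsees _ h2
            exact ⟨y, hy, fun _ => hyd⟩
          · exact ⟨c + 2, sees_self k l _, fun h => absurd h h2⟩
        obtain ⟨x, hx, hxy⟩ := exists_compat_edge k l _ _ y h21.symm hy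
        exact ⟨x, y, hx, hy, by rwa [compat_comm], fun h => absurd h h1, hyd⟩
    obtain ⟨e, rfl, rfl, hcard, he, hcompat⟩ := exists_compat_extension hx hy hxy
    refine ⟨i ∘ e, ⟨?_, fun a => ⟨e a, he a, rfl⟩, fun a b p q hab hpq _ h => ?_⟩, fun a ha => ?_⟩
    · rw [← Finset.image_image]
      exact Finset.card_image_le.trans hcard
    · by_contra! hcon
      obtain rfl := hi hcon.1
      obtain rfl := hi hcon.2
      exact (compat_iff.mp (hcompat a b hab)).1 hpq h
    · obtain rfl | rfl | rfl := eq_or_eq_add_one_or_eq_add_two c a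
      · exact absurd ha hc
      · exact hxA ha
      · exact hyA ha
  -- With a repeated input at most two values exist and the edge condition is void, so the vertices
  -- outside `A` can decide their own inputs.
  · refine ⟨fun a => if a ∈ A then d a else i a, ⟨?_, fun a => ?_, fun _ _ _ _ _ _ h => absurd h hi⟩,
      fun a ha => if_pos ha⟩
    · have hlt : (Finset.univ.image i).card < 3 :=
        lt_of_le_of_ne (by simpa using Finset.card_image_le (s := Finset.univ) (f := i))
          (mt card_image_eq_three_iff.mp hi)
      refine (Finset.card_le_card fun w hw => ?_).trans (Nat.le_of_lt_succ hlt)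
      obtain ⟨a, -, rfl⟩ := Finset.mem_image.mp hw
      split_ifs with ha
      · obtain ⟨q, -, hq⟩ := hsees a ha
        exact Finset.mem_image.mpr ⟨q, Finset.mem_univ _, hq⟩
      · exact Finset.mem_image_of_mem _ (Finset.mem_univ _)
    · split_ifs with ha
      · exact hsees a ha
      · exact ⟨a, sees_self k l a, rfl⟩

/-- The decisions on the common vertices remain allowed in the second run, since their views are
unchanged; the missing colour `c` makes the extension possible. -/
theorem Decides.exists_of_common {i i' : Fin 3 → Fin 3} {k l k' l' : Fin 13} {d : Fin 3 → Fin 3}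
    (hd : Decides i k l d) {c : Fin 3} (hc : vertexThree i k l c ≠ vertexThree i' k' l' c) :
    ∃ d', Decides i' k' l' d' ∧
      ∀ a, vertexThree i k l a = vertexThree i' k' l' a → d' a = d a := by
  refine exists_decides_extension (A := {a | vertexThree i k l a = vertexThree i' k' l' a}) hc
    (fun a ha => ?_) (fun a ha b hb p q hab hpq hi' h => ?_)
  · obtain ⟨q, hq, hqd⟩ := hd.exists_sees a
    refine ⟨q, shapeThree_eq_of_vertexThree_eq ha ▸ hq, ?_⟩
    rw [← input_eq_of_vertexThree_eq ha hq, hqd]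
  · have ha' := shapeThree_eq_of_vertexThree_eq ha
    have hb' := shapeThree_eq_of_vertexThree_eq hb
    have hsees := sees_of_shapeRel k' l' p q a b hpq hab h
    rw [← ha', ← hb'] at h hsees
    -- The constraint is available in the first run only for injective input; a constrained edge
    -- sees all inputs, so both runs have the same input.
    have hi : i = i' := by
      funext x
      obtain rfl | rfl | rfl := eq_or_eq_or_eq_neg_add a b x hab
      · exact input_eq_of_vertexThree_eq ha (sees_self k l _)
      · exact input_eq_of_vertexThree_eq hb (sees_self k l _)
      · exact hsees.elim (input_eq_of_vertexThree_eq ha) (input_eq_of_vertexThree_eq hb)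
    subst hi
    exact hd.ne_or_ne a b p q hab hpq hi' h

theorem mem_labels_productUpdate {Ag Vin α β : Type} [Fintype Ag] [DecidableEq Ag]
    {M : SimplicialModel Ag Vin α} {A : ActionModel Ag Vin β} {X : Finset (α × β)}
    {p : Atom Ag Vin} : p ∈ (productUpdate M A).labels X ↔ ∃ x ∈ X, p ∈ M.l x.1 := by
  simp only [SimplicialModel.labels, Set.mem_iUnion, exists_prop]
  rfl

theorem labels_facet_eq (i : Fin 3 → Fin 3) (v : Fin 3 → Views (Fin 3) (Fin 3) 2)
    (d : Fin 3 → Fin 3) :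
    (inputIS 2).labels (snapFacet i v) = (inputSA 2).labels (agreeFacet i d) := by
  ext p
  rw [mem_labels_productUpdate, mem_labels_productUpdate]
  constructor
  · rintro ⟨x, hx, hp⟩
    refine ⟨((x.1.1, i x.1.1), (x.1.1, d x.1.1)), mem_agreeFacet.mpr rfl, ?_⟩
    rwa [mem_snapFacet.mp hx] at hp
  · rintro ⟨x, hx, hp⟩
    refine ⟨snapVertex x.1.1 (i x.1.1) (v x.1.1), mem_snapFacet.mpr rfl, ?_⟩
    rwa [mem_agreeFacet.mp hx] at hp

theorem isTotalDSimulation_simS : IsTotalDSimulation (inputIS 2) (inputSA 2) simS where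
  facet := fun _ _ h => ⟨h.1, h.2.1⟩
  atom := by
    rintro _ _ ⟨-, -, i, v, i', d, rfl, rfl, hi, -⟩
    obtain rfl : i = i' := funext hi
    exact labels_facet_eq i v d
  forth := by
    intro X hX Y hY X' hX' h
    obtain ⟨i, k, l, rfl⟩ := mem_facets_inputIS_two.mp hX
    obtain ⟨i', k', l', rfl⟩ := mem_facets_inputIS_two.mp hY
    -- The extension needs a colour that is not shared. When all vertices are shared, the facets
    -- coincide and `X'` serves again.
    by_cases hall : ∀ a, vertexThree i k l a = vertexThree i' k' l' a
    · have hXY : facetThree i k l = facetThree i' k' l' := by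
        ext x
        simp only [mem_facetThree, hall]
      refine ⟨X', hX', hXY ▸ h, ?_⟩
      rintro a -
      obtain ⟨x, ⟨hx, hxa⟩, -⟩ := (inputSA 2).pure.colorful hX' a
      exact ⟨x, ⟨hx, hx⟩, hxa⟩
    · obtain ⟨c, hc⟩ := not_forall.mp hall
      obtain ⟨d, hd, rfl⟩ := simS_facetThree_iff.mp h
      obtain ⟨d', hd', heq⟩ := hd.exists_of_common hc
      have hS : simS (facetThree i' k' l') (agreeFacet i' d') :=
        simS_facetThree_iff.mpr ⟨d', hd', rfl⟩
      refine ⟨agreeFacet i' d', hS.2.1, hS, ?_⟩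
      rintro _ ⟨x, ⟨hx, hy⟩, rfl⟩
      obtain ⟨a, rfl⟩ := mem_facetThree.mp hx
      obtain ⟨b, hb⟩ := mem_facetThree.mp hy
      obtain rfl := color_eq_of_vertexThree_eq hb
      refine ⟨((b, i b), (b, d b)), ⟨mem_agreeFacet.mpr rfl, mem_agreeFacet.mpr ?_⟩, rfl⟩
      have hib : i b = i' b := input_eq_of_vertexThree_eq hb.symm (sees_self k l b)
      simp only [hib, heq b hb.symm]
  total := by
    intro X hX
    obtain ⟨i, k, l, rfl⟩ := mem_facets_inputIS_two.mp hX
    -- Totality is the extension of the empty partial decision; the given `d` and `c` play no role.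
    obtain ⟨d, hd, -⟩ := exists_decides_extension (i := i) (k := k) (l := l) (d := i) (A := ∅)
      (c := 0) (by simp) (by simp) (by simp)
    have hS := simS_facetThree_iff.mpr ⟨d, hd, rfl⟩
    exact ⟨_, hS.2.1, hS⟩

/-! ### Forgetting all rounds but the first two -/

section Truncation

variable {Ag Vin : Type} [Fintype Ag] [DecidableEq Ag]

theorem OrderedPartition.mem_block_self (γ : OrderedPartition Ag) (a : Ag) : a ∈ γ.block a := by
  unfold OrderedPartition.block
  cases h : γ.blocks.find? fun C => decide (a ∈ C) with
  | none => simp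
  | some C => simpa using List.find?_some h

/-- The view of `a` after the first two of `n + 2` rounds, read off from its final view. -/
def truncView (a : Ag) : (n : ℕ) → Views Ag Vin (n + 2) → Views Ag Vin 2
  | 0, v => v
  -- The default is never reached on an actual view, because every process lies in its own block.
  | n + 1, v => truncView a n (Option.getD (v a) fun _ => none)

theorem truncView_view (i : Ag → Vin) (a : Ag) : ∀ (n : ℕ) (γ : Fin (n + 2) → OrderedPartition Ag),
    truncView a n (view i (n + 2) γ a) = view i 2 ![γ 0, γ 1] a
  | 0, γ => by
    have : γ = ![γ 0, γ 1] := by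
      funext j
      fin_cases j <;> rfl
    rw [← this]
    rfl
  | n + 1, γ => by
    have h : view i (n + 3) γ a a = some (view i (n + 2) (fun j => γ j.castSucc) a) :=
      if_pos ((γ (Fin.last (n + 2))).mem_block_self a)
    change truncView a n (Option.getD (view i (n + 3) γ a a) fun _ => none) = _
    rw [h]
    exact truncView_view i a n fun j => γ j.castSucc

/-- Forgetting all rounds but the first two. -/
def truncVertex (n : ℕ) (x : SnapVertex Ag Vin (n + 2)) : SnapVertex Ag Vin 2 :=
  (x.1, x.2.1, x.2.2.1, truncView x.1.1 n x.2.2.2)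

theorem image_truncVertex_runFacet (n : ℕ) (i : Ag → Vin)
    (γ : Fin (n + 2) → OrderedPartition Ag) :
    truncVertex n '' (runFacet i γ : Set (SnapVertex Ag Vin (n + 2))) =
      (runFacet i ![γ 0, γ 1] : Set (SnapVertex Ag Vin 2)) := by
  have key : ∀ a, truncVertex n (snapVertex a (i a) (view i (n + 2) γ a)) =
      snapVertex a (i a) (view i 2 ![γ 0, γ 1] a) := fun a => by
    rw [← truncView_view]
    rfl
  ext y
  constructor
  · rintro ⟨x, hx, rfl⟩
    rw [mem_snapFacet.mp hx, key]
    exact mem_snapFacet.mpr rfl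
  · intro hy
    exact ⟨snapVertex y.1.1 (i y.1.1) (view i (n + 2) γ y.1.1), mem_snapFacet.mpr rfl,
      (key _).trans (mem_snapFacet.mp hy).symm⟩

theorem isMorphism_truncVertex [Inhabited Ag] [Inhabited Vin] (n : ℕ) :
    IsMorphism (productUpdate (inputModel Ag Vin) (snapshot Ag Vin (n + 2)))
      (productUpdate (inputModel Ag Vin) (snapshot Ag Vin 2)) (truncVertex n) where
  map_simplex := by
    classical
    intro X hX
    obtain ⟨Y, hY, hXY⟩ := exists_superset_facet hX
    obtain ⟨i, γ, rfl⟩ := mem_facets_snapshotModel.mp hY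
    refine ⟨X.image (truncVertex n), ?_, Finset.coe_image⟩
    have hZ := (mem_facets_snapshotModel (r := 2)).mpr ⟨i, ![γ 0, γ 1], rfl⟩
    refine ((productUpdate _ _).isRelLowerSet_faces hZ.prop).2 ?_
      (((productUpdate _ _).isRelLowerSet_faces hX).1.image _)
    rw [← Finset.coe_subset, Finset.coe_image, ← image_truncVertex_runFacet]
    exact Set.image_mono (Finset.coe_subset.mpr hXY)
  map_color := fun _ _ => rfl
  map_label := fun _ _ => rfl

end Truncation

end SimplicialEpistemic

open SimplicialEpistemic

theorem mainTheorem2 :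
    (∀ r : ℕ, 2 ≤ r → ¬ ∃ φ : FormulaD (Fin 3) (Fin 3),
      IsLogicalObstruction inputThree (setAgreement (Fin 3) (Fin 3) 2)
        (snapshot (Fin 3) (Fin 3) r) φ) ∧
    IsTotalDSimulation (inputIS 2) (inputSA 2) simS ∧
    (∀ (r : ℕ) (hr : 3 ≤ r), ∃ f : SnapVertex (Fin 3) (Fin 3) r → SnapVertex (Fin 3) (Fin 3) 2,
      IsMorphism (inputIS r) (inputIS 2) f ∧
      ∀ (i : Fin 3 → Fin 3) (γ : Fin r → OrderedPartition (Fin 3)),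
        f '' (runFacet i γ : Set (SnapVertex (Fin 3) (Fin 3) r)) =
          (runFacet i ![γ ⟨0, by omega⟩, γ ⟨1, by omega⟩] :
            Set (SnapVertex (Fin 3) (Fin 3) 2))) := by
  refine ⟨fun r hr => ?_, isTotalDSimulation_simS, fun r hr => ?_⟩
  -- Here `r = n + 2`, and `r = 2` is the case `n = 0`, where truncation changes nothing.
  · obtain ⟨n, rfl⟩ := Nat.exists_eq_add_of_le' hr
    rintro ⟨φ, hφ⟩
    exact not_isLogicalObstruction_of_isTotalDSimulation
      (isTotalDSimulation_simS.comp_isMorphism (isMorphism_truncVertex n)) φ hφ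
  · obtain ⟨n, rfl⟩ := Nat.exists_eq_add_of_le' (show 2 ≤ r by omega)
    exact ⟨truncVertex n, isMorphism_truncVertex n, image_truncVertex_runFacet n⟩
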